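/- Let $\mathcal V$ be a descent category: a category with finite limits together with a class of morphisms, called covers, which contains all identities, is closed under composition and under pullback, and is such that if $f$ and $gf$ are covers, then $g$ is a cover. A simplicial space is a simplicial object in $\mathcal V$. For a finite simplicial set $T$ (finitely many nondegenerate simplices) and a simplicial space $X$, let $\mathrm{Map}(T,X)\in\mathcal V$ be the finite limit that represents simplicial maps from $T$ to $X$ (the limit of the spaces $X_m$ over all $m$ and all simplices in $T_m$), so that $\mathrm{Map}(\Delta^n,X)\cong X_n$. Let $\Lambda^n_i=\bigcup_{j\ne i}\partial_j\Delta^n$ be the horn. Let $k\ge0$. A simplicial space $X$ is a $k$-groupoid if, for all $0\le i\le n$, the morphism $X_n\to\mathrm{Map}(\Lambda^n_i,X)$ is a cover for $n>0$ and an isomorphism for $n>k$. A morphism $f:X\to Y$ of simplicial spaces is a hypercover if $X_n\to\mathrm{Map}(\partial\Delta^n,X)\times_{\mathrm{Map}(\partial\Delta^n,Y)}Y_n$ is a cover for all $n\ge0$. Let $P_1Y$ be the simplicial space with $(P_1Y)_m=\mathrm{Map}(\Delta^m\times\Delta^1,Y)$, and let $e_0,e_1:P_1Y\to Y$ be the evaluations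 at the vertices $0$ and $1$ of $\Delta^1$. For a morphism $f:X\to Y$, let $P(f)$ be the fibre product $X\times_YP_1Y$ of $f$ and $e_0$, and let $q(f):P(f)\to Y$ be its projection to $P_1Y$ followed by $e_1$. A morphism $f:X\to Y$ of $k$-groupoids is a weak equivalence if $q(f)$ is a hypercover. Theorem. A morphism $f:X\to Y$ of $k$-groupoids in $\mathcal V$ is a weak equivalence if and only if, for every $n\ge0$, the morphism $$X_n\times_{Y_n}Y_{n+1}\longrightarrow \mathrm{Map}(\partial\Delta^n,X)\times_{\mathrm{Map}(\partial\Delta^n,Y)}\mathrm{Map}(\Lambda^{n+1}_{n+1},Y)$$ is a cover. Here $Y_{n+1}\to Y_n$ is the face map $\partial_{n+1}$, restriction along the last face $\Delta^n=\partial_{n+1}\Delta^{n+1}\hookrightarrow\Delta^{n+1}$, and $\mathrm{Map}(\Lambda^{n+1}_{n+1},Y)\to\mathrm{Map}(\partial\Delta^n,Y)$ is restriction along the inclusion of the boundary $\partial\Delta^n$ of that face into the horn. -/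

import Mathlib

open CategoryTheory CategoryTheory.Limits Opposite Simplicial MonoidalCategory

universe v u

namespace HigherGroupoid

/-! ### Descent categories -/

/-- A class of morphisms `cover` (the covers) makes the category `C` with finite limits a descent
category if the covers form a (wide) subcategory, pullbacks of covers are covers, and `g` is a
cover whenever `f` and the composition of `f` followed by `g` are covers. -/
class IsDescent {C : Type u} [Category.{v} C] [HasFiniteLimits C]
    (cover : MorphismProperty C) : Prop where
  id_mem : ∀ X : C, cover (𝟙 X)
  comp_mem : ∀ {X Y Z : C} (f : X ⟶ Y) (g : Y ⟶ Z), cover f → cover g → cover (f ≫ g)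
  of_isPullback : ∀ {P X Y Z : C} {fst : P ⟶ X} {snd : P ⟶ Y} {f : X ⟶ Z} {g : Y ⟶ Z},
    IsPullback fst snd f g → cover f → cover snd
  of_precomp : ∀ {X Y Z : C} (f : X ⟶ Y) (g : Y ⟶ Z), cover f → cover (f ≫ g) → cover g

/-! ### Finiteness of the limit over the simplices of a finite simplicial set -/

/-- The simplices of `T` of dimension `< d`, in the category of elements of `T`. -/
abbrev elementsLT (T : SSet.{0}) (d : ℕ) : ObjectProperty T.Elements :=
  fun e => e.1.unop.len < d

instance (T : SSet.{0}) [T.Finite] (d : ℕ) : Finite (elementsLT T d).FullSubcategory := by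
  let F : (elementsLT T d).FullSubcategory → Σ i : Fin d, T.obj (op ⦋i.1⦌) :=
    fun e => ⟨⟨e.obj.1.unop.len, e.property⟩, e.obj.2⟩
  refine Finite.of_injective F ?_
  rintro ⟨⟨⟨⟨a⟩⟩, x⟩, ha⟩ ⟨⟨⟨⟨b⟩⟩, y⟩, hb⟩ h
  simp only [F, Sigma.mk.injEq, Fin.mk.injEq] at h
  obtain ⟨h1, h2⟩ := h
  change a = b at h1
  subst h1
  have h3 : x = y := eq_of_heq h2
  subst h3
  rfl

instance (T : SSet.{0}) (a b : T.Elements) : Finite (a ⟶ b) :=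
  have : Finite (b.1.unop ⟶ a.1.unop) := inferInstance
  Finite.of_injective (β := b.1.unop ⟶ a.1.unop) (fun f => f.1.unop)
    (fun _ _ h => Subtype.ext (Quiver.Hom.unop_inj h))

noncomputable instance (T : SSet.{0}) [T.Finite] (d : ℕ) :
    FinCategory (elementsLT T d).FullSubcategory where
  fintypeObj := Fintype.ofFinite _
  fintypeHom a b :=
    have : Finite (a ⟶ b) := Finite.of_injective (fun f => f.hom)
      (fun _ _ h => ObjectProperty.hom_ext _ h)
    Fintype.ofFinite _

/-- If `T` has dimension `< d`, a limit over all simplices of `T` may be computed over the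
simplices of dimension `< d`. -/
lemma initial_elementsLT (T : SSet.{0}) (d : ℕ) [T.HasDimensionLT d] :
    (elementsLT T d).ι.Initial := by
  constructor
  intro b
  obtain ⟨⟨a⟩, y⟩ := b
  induction a using SimplexCategory.rec with | _ n
  obtain ⟨m, f, hf, z, hz⟩ := T.exists_nonDegenerate y
  let c : T.Elements := T.elementsMk (op ⦋n⦌) y
  let mkArrow (q : ℕ) (w : T.obj (op ⦋q⦌)) (hq : q < d) (g : ⦋n⦌ ⟶ ⦋q⦌) (hg : T.map g.op w = y) :
      CostructuredArrow (elementsLT T d).ι c :=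
    CostructuredArrow.mk (Y := (⟨T.elementsMk (op ⦋q⦌) w, hq⟩ : (elementsLT T d).FullSubcategory))
      (CategoryOfElements.homMk (T.elementsMk (op ⦋q⦌) w) c g.op hg)
  have hom : ∀ (q : ℕ) (w : T.obj (op ⦋q⦌)) (hq : q < d) (g : ⦋n⦌ ⟶ ⦋q⦌) (hg : T.map g.op w = y)
      (q' : ℕ) (w' : T.obj (op ⦋q'⦌)) (hq' : q' < d) (g' : ⦋n⦌ ⟶ ⦋q'⦌) (hg' : T.map g'.op w' = y)
      (h : ⦋q⦌ ⟶ ⦋q'⦌) (_ : T.map h.op w' = w) (_ : g ≫ h = g'),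
      Nonempty (mkArrow q' w' hq' g' hg' ⟶ mkArrow q w hq g hg) := by
    intro q w hq g hg q' w' hq' g' hg' h h1 h2
    refine ⟨CostructuredArrow.homMk
      (ObjectProperty.homMk (CategoryOfElements.homMk _ _ h.op h1)) ?_⟩
    apply CategoryOfElements.ext
    change h.op ≫ g.op = g'.op
    rw [← h2]; rfl
  let base := mkArrow m z (T.dim_lt_of_nonDegenerate z d) f hz.symm
  have key : ∀ (q : ℕ) (w : T.obj (op ⦋q⦌)) (hq : q < d) (g : ⦋n⦌ ⟶ ⦋q⦌) (hg : T.map g.op w = y),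
      Zigzag (mkArrow q w hq g hg) base := by
    intro q w hq g hg
    obtain ⟨r, e, i, he, hi, hei⟩ : ∃ (r : ℕ) (e : ⦋n⦌ ⟶ ⦋r⦌) (i : ⦋r⦌ ⟶ ⦋q⦌),
        Epi e ∧ Mono i ∧ e ≫ i = g :=
      ⟨_, factorThruImage g, image.ι g, inferInstance, inferInstance, image.fac g⟩
    have hr : r < d := lt_of_le_of_lt (SimplexCategory.le_of_mono i) hq
    obtain ⟨s, k, hk, t, ht⟩ := T.exists_nonDegenerate (T.map i.op w)
    have h1 : T.map e.op (T.map i.op w) = y := by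
      rw [← hg, ← hei]; simp
    have h2 : T.map (e ≫ k).op t = y := by
      rw [← h1, ht]; simp
    have hs := T.dim_lt_of_nonDegenerate t d
    obtain ⟨a1⟩ := hom r _ hr e h1 q w hq g hg i rfl hei
    obtain ⟨a2⟩ := hom r _ hr e h1 s t hs (e ≫ k) h2 k ht.symm rfl
    have hms : m = s := T.unique_nonDegenerate_dim y f z hz (e ≫ k) t h2.symm
    subst hms
    have hzt : z = t := T.unique_nonDegenerate_simplex y f z hz (e ≫ k) t h2.symm
    subst hzt
    have hfk : f = e ≫ k := T.unique_nonDegenerate_map y f z hz (e ≫ k) z h2.symm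
    subst hfk
    exact (Zigzag.of_hom a1).trans (Zigzag.of_inv a2)
  have : Nonempty (CostructuredArrow (elementsLT T d).ι c) := ⟨base⟩
  change IsConnected (CostructuredArrow (elementsLT T d).ι c)
  refine zigzag_isConnected ?_
  have key' : ∀ c, Zigzag c base := by
    rintro ⟨⟨⟨⟨a⟩, w⟩, hq⟩, ⟨⟩, φ⟩
    induction a using SimplexCategory.rec with | _ q
    exact key q w hq φ.1.unop φ.2
  intro c c'
  exact (key' c).trans (key' c').symm

section

variable {C : Type u} [Category.{v} C] [HasFiniteLimits C]

instance (T : SSet.{0}) [T.Finite] (X : SimplicialObject C) :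
    HasLimit (CategoryOfElements.π T ⋙ X) := by
  obtain ⟨d, _⟩ := T.hasDimensionLT_of_finite
  have := initial_elementsLT T d
  exact Functor.Initial.hasLimit_of_comp (elementsLT T d).ι

/-! ### Mapping spaces -/

/-- `Map T X`, the space of simplicial morphisms from the finite simplicial set `T` to the
simplicial space `X`: the limit of the `X_m` over all simplices `x : T_m` of `T`. A generalized
element of it is a family of elements of the `X_m`, one for each `x : T_m`, which is compatible
with all simplicial operators. -/
noncomputable def Map (T : SSet.{0}) [T.Finite] (X : SimplicialObject C) : C :=
  limit (CategoryOfElements.π T ⋙ X)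

/-- Evaluation of simplicial morphisms `T ⟶ X` at a simplex of `T`. -/
noncomputable def Map.ev {T : SSet.{0}} [T.Finite] (X : SimplicialObject C)
    {m : SimplexCategoryᵒᵖ} (x : T.obj m) : Map T X ⟶ X.obj m :=
  limit.π (CategoryOfElements.π T ⋙ X) (T.elementsMk m x)

lemma Map.ev_map {T : SSet.{0}} [T.Finite] (X : SimplicialObject C)
    {m m' : SimplexCategoryᵒᵖ} (g : m ⟶ m') (x : T.obj m) :
    Map.ev X x ≫ X.map g = Map.ev X (T.map g x) :=
  limit.w (CategoryOfElements.π T ⋙ X)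
    (CategoryOfElements.homMk (T.elementsMk m x) (T.elementsMk m' (T.map g x)) g rfl)

/-- A compatible family of morphisms `A ⟶ X_m`, indexed by the simplices of `T`, induces a
morphism `A ⟶ Map T X`. -/
noncomputable def Map.lift {T : SSet.{0}} [T.Finite] {X : SimplicialObject C} {A : C}
    (s : ∀ m : SimplexCategoryᵒᵖ, T.obj m → (A ⟶ X.obj m))
    (hs : ∀ (m m' : SimplexCategoryᵒᵖ) (g : m ⟶ m') (x : T.obj m),
      s m x ≫ X.map g = s m' (T.map g x)) : A ⟶ Map T X :=
  limit.lift (CategoryOfElements.π T ⋙ X)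
    { pt := A
      π :=
        { app := fun e => s e.1 e.2
          naturality := fun e e' g => by
            have h := hs e.1 e'.1 g.1 e.2
            rw [g.2] at h
            change 𝟙 A ≫ s e'.1 e'.2 = s e.1 e.2 ≫ X.map g.1
            rw [Category.id_comp, h] } }

@[simp]
lemma Map.lift_ev {T : SSet.{0}} [T.Finite] {X : SimplicialObject C} {A : C}
    (s : ∀ m : SimplexCategoryᵒᵖ, T.obj m → (A ⟶ X.obj m))
    (hs : ∀ (m m' : SimplexCategoryᵒᵖ) (g : m ⟶ m') (x : T.obj m),
      s m x ≫ X.map g = s m' (T.map g x)) {m : SimplexCategoryᵒᵖ} (x : T.obj m) :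
    Map.lift s hs ≫ Map.ev X x = s m x :=
  limit.lift_π _ _

lemma Map.hom_ext {T : SSet.{0}} [T.Finite] {X : SimplicialObject C} {A : C}
    {a b : A ⟶ Map T X}
    (h : ∀ (m : SimplexCategoryᵒᵖ) (x : T.obj m), a ≫ Map.ev X x = b ≫ Map.ev X x) : a = b :=
  limit.hom_ext fun e => h e.1 e.2

/-- Restriction `Map T X ⟶ Map S X` along a map of finite simplicial sets `S ⟶ T`. -/
noncomputable def Map.restr {S T : SSet.{0}} [S.Finite] [T.Finite] (i : S ⟶ T)
    (X : SimplicialObject C) : Map T X ⟶ Map S X :=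
  Map.lift (fun m x => Map.ev X (i.app m x)) fun m m' g x => by
    rw [Map.ev_map, NatTrans.naturality_apply]

@[simp]
lemma Map.restr_ev {S T : SSet.{0}} [S.Finite] [T.Finite] (i : S ⟶ T)
    (X : SimplicialObject C) {m : SimplexCategoryᵒᵖ} (x : S.obj m) :
    Map.restr i X ≫ Map.ev X x = Map.ev X (i.app m x) :=
  Map.lift_ev _ _ x

/-- The morphism `Map T X ⟶ Map T Y` given by composition with `f : X ⟶ Y`. -/
noncomputable def Map.post (T : SSet.{0}) [T.Finite] {X Y : SimplicialObject C} (f : X ⟶ Y) :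
    Map T X ⟶ Map T Y :=
  Map.lift (fun m x => Map.ev X x ≫ f.app m) fun m m' g x => by
    rw [Category.assoc, ← NatTrans.naturality, ← Category.assoc, Map.ev_map]

@[simp]
lemma Map.post_ev (T : SSet.{0}) [T.Finite] {X Y : SimplicialObject C} (f : X ⟶ Y)
    {m : SimplexCategoryᵒᵖ} (x : T.obj m) :
    Map.post T f ≫ Map.ev Y x = Map.ev X x ≫ f.app m :=
  Map.lift_ev _ _ x

/-- For a simplicial subset `A` of `Δ[n]`, the morphism `X_n ⟶ Map A X` that restricts the
tautological map `Δ[n] ⟶ X` to `A`: its component at the simplex `x : [m] ⟶ [n]` of `A` is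
`X(x) : X_n ⟶ X_m`. -/
noncomputable def Map.ofSimplex {n : ℕ} (A : (Δ[n] : SSet.{0}).Subcomplex)
    (X : SimplicialObject C) : X _⦋n⦌ ⟶ Map (A : SSet.{0}) X :=
  Map.lift (fun _ x => X.map (SSet.stdSimplex.objEquiv x.1).op) fun _ _ g x => by
    rw [← Functor.map_comp]
    rfl

@[simp]
lemma Map.ofSimplex_ev {n : ℕ} (A : (Δ[n] : SSet.{0}).Subcomplex)
    (X : SimplicialObject C) {m : SimplexCategoryᵒᵖ} (x : (A : SSet.{0}).obj m) :
    Map.ofSimplex A X ≫ Map.ev X x = X.map (SSet.stdSimplex.objEquiv x.1).op :=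
  Map.lift_ev _ _ x

lemma Map.ofSimplex_post {n : ℕ} (A : (Δ[n] : SSet.{0}).Subcomplex)
    {X Y : SimplicialObject C} (f : X ⟶ Y) :
    Map.ofSimplex A X ≫ Map.post A f = f.app (op ⦋n⦌) ≫ Map.ofSimplex A Y :=
  Map.hom_ext fun m x => by
    rw [Category.assoc, Category.assoc, Map.post_ev, Map.ofSimplex_ev, ← Category.assoc,
      Map.ofSimplex_ev, NatTrans.naturality]

/-! ### `k`-groupoids and hypercovers -/

/-- A simplicial space `X` is a `k`-groupoid if `X_n ⟶ Map Λ[n, i] X` is a cover for all `n > 0`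
and `0 ≤ i ≤ n`, and an isomorphism if moreover `n > k`. -/
structure IsKGroupoid (cover : MorphismProperty C) (k : ℕ) (X : SimplicialObject C) : Prop where
  cover_horn : ∀ (n : ℕ) (i : Fin (n + 1)), 0 < n → cover (Map.ofSimplex (SSet.horn n i) X)
  isIso_horn : ∀ (n : ℕ) (i : Fin (n + 1)), k < n → IsIso (Map.ofSimplex (SSet.horn n i) X)

/-- The morphism `X_n ⟶ Map ∂Δ[n] X ×_{Map ∂Δ[n] Y} Y_n`. -/
noncomputable def matchingMap {X Y : SimplicialObject C} (f : X ⟶ Y) (n : ℕ) :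
    X _⦋n⦌ ⟶ pullback (Map.post (SSet.boundary n) f) (Map.ofSimplex (SSet.boundary n) Y) :=
  pullback.lift (Map.ofSimplex (SSet.boundary n) X) (f.app (op ⦋n⦌)) (Map.ofSimplex_post _ f)

/-- A morphism of simplicial spaces is a hypercover if all its matching maps are covers. -/
def IsHypercover (cover : MorphismProperty C) {X Y : SimplicialObject C} (f : X ⟶ Y) : Prop :=
  ∀ n : ℕ, cover (matchingMap f n)

/-! ### Path spaces and weak equivalences -/

/-- The simplicial space `P_n X` with `(P_n X)_m = Map (Δ[m] × Δ[n]) X`. -/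
noncomputable def P (n : ℕ) (X : SimplicialObject C) : SimplicialObject C where
  obj m := Map (SSet.stdSimplex.{0}.obj m.unop ⊗ Δ[n]) X
  map g := Map.restr (SSet.stdSimplex.{0}.map g.unop ▷ Δ[n]) X
  map_id m := Map.hom_ext fun _ x => by
    rw [Map.restr_ev, Category.id_comp]
    refine congrArg (Map.ev X) (Prod.ext (SSet.stdSimplex.objEquiv.injective ?_) rfl)
    change SSet.stdSimplex.objEquiv x.1 ≫ 𝟙 m.unop = SSet.stdSimplex.objEquiv x.1
    rw [Category.comp_id]
  map_comp g h := Map.hom_ext fun _ x => by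
    rw [Map.restr_ev, Category.assoc, Map.restr_ev, Map.restr_ev]
    exact congrArg (Map.ev X) rfl

/-- Evaluation `P_n X ⟶ X` at the vertex `i` of `Δ[n]`: in degree `m`, the restriction along
`Δ[m] = Δ[m] × {i} ⟶ Δ[m] × Δ[n]`, that is, evaluation at the `m`-simplex `(id, i)` of the
prism. -/
noncomputable def P.evVertex (n : ℕ) (i : Fin (n + 1)) (X : SimplicialObject C) : P n X ⟶ X where
  app m := Map.ev (T := SSet.stdSimplex.{0}.obj m.unop ⊗ Δ[n]) X
    (SSet.stdSimplex.objEquiv.symm (𝟙 m.unop), SSet.stdSimplex.const n i m)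
  naturality m m' g := by
    refine (Map.restr_ev _ _ _).trans (Eq.trans ?_ (Map.ev_map X g _).symm)
    refine congrArg (Map.ev X) (Prod.ext ?_ rfl)
    change SSet.stdSimplex.objEquiv.symm (𝟙 m'.unop ≫ g.unop) =
      SSet.stdSimplex.objEquiv.symm (g.unop ≫ 𝟙 m.unop)
    rw [Category.id_comp, Category.comp_id]

/-- `P(f) = X ×_Y P_1 Y`, the space of pairs of a point `x` of `X` and a path in `Y` that starts
(at the vertex `0` of `Δ[1]`) at `f x`. -/
noncomputable def mappingPath {X Y : SimplicialObject C} (f : X ⟶ Y) : SimplicialObject C :=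
  pullback f (P.evVertex 1 0 Y)

/-- The morphism `q(f) : P(f) ⟶ Y` that takes a path to its end point. -/
noncomputable def mappingPath.q {X Y : SimplicialObject C} (f : X ⟶ Y) : mappingPath f ⟶ Y :=
  pullback.snd f (P.evVertex 1 0 Y) ≫ P.evVertex 1 1 Y

/-- `f` is a weak equivalence if `q(f) : P(f) ⟶ Y` is a hypercover. -/
def IsWeakEquivalence (cover : MorphismProperty C) {X Y : SimplicialObject C} (f : X ⟶ Y) : Prop :=
  IsHypercover cover (mappingPath.q f)

/-! ### The relative horn maps -/

/-- The inclusion `∂Δ[n] ⟶ Λ[n + 1, n + 1]` induced by the last face `Δ[n] ⟶ Δ[n + 1]`, which is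
the face that is missing from the horn. -/
def boundaryToHorn (n : ℕ) :
    (SSet.boundary n : SSet.{0}) ⟶ (SSet.horn (n + 1) (Fin.last (n + 1)) : SSet.{0}) :=
  SSet.Subcomplex.lift ((SSet.boundary n).ι ≫ SSet.stdSimplex.δ (Fin.last (n + 1))) (by
    rintro m _ ⟨⟨x, hx⟩, rfl⟩
    intro h
    refine hx fun j => ?_
    rcases Set.eq_univ_iff_forall.1 h j.castSucc with ⟨a, ha⟩ | h'
    · refine ⟨a, Fin.castSucc_injective _ ?_⟩
      rw [← ha, ← Fin.succAbove_last]
      rfl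
    · exact absurd h' (Fin.castSucc_ne_last j))

/-- The morphism `X_n ×_{Y_n} Y_{n+1} ⟶ Map ∂Δ[n] X ×_{Map ∂Δ[n] Y} Map Λ[n+1, n+1] Y`, where
`Y_{n+1} ⟶ Y_n` is the last face map. -/
noncomputable def relativeHornMap {X Y : SimplicialObject C} (f : X ⟶ Y) (n : ℕ) :
    pullback (f.app (op ⦋n⦌)) (Y.δ (Fin.last (n + 1))) ⟶
      pullback (Map.post (SSet.boundary n) f) (Map.restr (boundaryToHorn n) Y) :=
  pullback.map _ _ _ _ (Map.ofSimplex (SSet.boundary n) X)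
    (Map.ofSimplex (SSet.horn (n + 1) (Fin.last (n + 1))) Y)
    (Map.ofSimplex (SSet.boundary n) Y)
    (Map.ofSimplex_post _ f).symm
    (Map.hom_ext fun m x => by
      rw [Category.assoc, Category.assoc, Map.restr_ev, Map.ofSimplex_ev, Map.ofSimplex_ev]
      exact (Y.map_comp _ _).symm)

end

end HigherGroupoid

namespace HigherGroupoid

/-! In degree `n` a point of `P(f)` is a simplex `x` of `X_n` with a prism `Δ[n] × Δ[1] ⟶ Y` whose
bottom is `f x`. Up to isomorphism the matching map of `q(f)` is `pathMap f n`, which keeps the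
boundary of `x` and the top and sides of the prism (`cover_matchingMap_iff`). It remains to compare
`pathMap f n` with `relativeHornMap f n`, one `n` at a time.

The prism is built from its top and sides by attaching the shuffles `j = 0, …, n`, each along the
horn that lacks the facet without `(j, 1)`. For `j = n` this is the last horn, and the missing facet
is the bottom of the prism. So `pathMap f n` is a base change of `relativeHornMap f n` (last
shuffle, `isPullback_pathMapFst`) followed by a base change of a composite of base changes of horn
covers of `Y` (earlier shuffles, `cover_pathMapSnd`). This gives one direction.

Conversely, let `Δ[n+1] × Δ[1]` collapse to `Δ[n+1]` by the identity on the bottom and the last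
vertex on the top. The collapse turns a relative horn into a target point of `pathMap f n`
(`hornToPath`). A lift of that point is a simplex of `X` and a prism over the last face. Together
with the collapsed horn this prism covers the top and sides over `Δ[n+1]`; the bottom of any
extension to the whole prism is the required filler.

The space of such extensions is `hornPrism f n`. It is a cover of the base change of `pathMap f n`
along `hornToPath f n` (`isPullback_hornPrism`), hence of the target of `relativeHornMap f n`, and
this morphism factors through the source by taking the bottom. To cancel, that first factor must be
a cover too, which holds because maps to `Y` extend to the prism from the union of its bottom, its
top and the part over the horn (`cover_restr_lowerHorn`, a second filtration by shuffles). -/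

/-- A commutative square which satisfies the universal property of a pullback on generalized
elements is a pullback square. -/
lemma isPullback_of_elements {C : Type u} [Category.{v} C] {P X Y Z : C} {fst : P ⟶ X}
    {snd : P ⟶ Y} {f : X ⟶ Z} {g : Y ⟶ Z} (w : fst ≫ f = snd ≫ g)
    (ex : ∀ {A : C} (a : A ⟶ X) (b : A ⟶ Y), a ≫ f = b ≫ g →
      ∃ l : A ⟶ P, l ≫ fst = a ∧ l ≫ snd = b)
    (uniq : ∀ {A : C} (l l' : A ⟶ P), l ≫ fst = l' ≫ fst → l ≫ snd = l' ≫ snd → l = l') :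
    IsPullback fst snd f g :=
  ⟨⟨w⟩, ⟨PullbackCone.IsLimit.mk w (fun s => (ex s.fst s.snd s.condition).choose)
    (fun s => (ex s.fst s.snd s.condition).choose_spec.1)
    (fun s => (ex s.fst s.snd s.condition).choose_spec.2)
    (fun s _ h₁ h₂ => uniq _ _
      (h₁.trans (ex s.fst s.snd s.condition).choose_spec.1.symm)
      (h₂.trans (ex s.fst s.snd s.condition).choose_spec.2.symm))⟩⟩

section

variable {C : Type u} [Category.{v} C] [HasFiniteLimits C]

/-! ### Functoriality of mapping spaces -/

namespace Map

lemma restr_comp {R S T : SSet.{0}} [R.Finite] [S.Finite] [T.Finite] (i : R ⟶ S) (j : S ⟶ T)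
    (X : SimplicialObject C) : restr (i ≫ j) X = restr j X ≫ restr i X :=
  hom_ext fun m x => by simp only [restr_ev, Category.assoc]; rfl

lemma restr_id (T : SSet.{0}) [T.Finite] (X : SimplicialObject C) : restr (𝟙 T) X = 𝟙 _ :=
  hom_ext fun m x => by simp only [restr_ev, Category.id_comp]; rfl

lemma isIso_restr {S T : SSet.{0}} [S.Finite] [T.Finite] (i : S ⟶ T) [IsIso i]
    (X : SimplicialObject C) : IsIso (restr i X) :=
  ⟨restr (inv i) X, by rw [← restr_comp, IsIso.inv_hom_id, restr_id],
    by rw [← restr_comp, IsIso.hom_inv_id, restr_id]⟩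

lemma post_comp (T : SSet.{0}) [T.Finite] {X Y Z : SimplicialObject C} (f : X ⟶ Y) (g : Y ⟶ Z) :
    post T (f ≫ g) = post T f ≫ post T g :=
  hom_ext fun m x => by
    rw [post_ev, Category.assoc, post_ev, ← Category.assoc, post_ev, Category.assoc,
      NatTrans.comp_app]

/-- The morphism `X_n ⟶ Map T X` induced by a map `T ⟶ Δ[n]`. -/
noncomputable def ofHom {T : SSet.{0}} [T.Finite] {n : ℕ} (g : T ⟶ Δ[n])
    (X : SimplicialObject C) : X _⦋n⦌ ⟶ Map T X :=
  Map.lift (fun m x => X.map (SSet.stdSimplex.objEquiv (g.app m x)).op) fun m m' h x => by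
    rw [← Functor.map_comp, NatTrans.naturality_apply]
    rfl

lemma ofHom_ev {T : SSet.{0}} [T.Finite] {n : ℕ} (g : T ⟶ Δ[n]) (X : SimplicialObject C)
    {m : SimplexCategoryᵒᵖ} (x : T.obj m) :
    ofHom g X ≫ ev X x = X.map (SSet.stdSimplex.objEquiv (g.app m x)).op :=
  Map.lift_ev _ _ x

lemma ofHom_restr {S T : SSet.{0}} [S.Finite] [T.Finite] (i : S ⟶ T) {n : ℕ} (g : T ⟶ Δ[n])
    (X : SimplicialObject C) : ofHom g X ≫ restr i X = ofHom (i ≫ g) X :=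
  hom_ext fun m x => by
    rw [Category.assoc, restr_ev, ofHom_ev, ofHom_ev]; rfl

lemma ofSimplex_eq {n : ℕ} (A : (Δ[n] : SSet.{0}).Subcomplex) (X : SimplicialObject C) :
    ofSimplex A X = ofHom A.ι X := rfl

/-- The evaluation of a map `T ⟶ X` at the simplex of `T` that corresponds to `Δ[n] ⟶ T`. -/
noncomputable def evHom {T : SSet.{0}} [T.Finite] {n : ℕ} (g : Δ[n] ⟶ T)
    (X : SimplicialObject C) : Map T X ⟶ X _⦋n⦌ :=
  ev X (m := op ⦋n⦌) (SSet.yonedaEquiv g)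

lemma restr_evHom {S T : SSet.{0}} [S.Finite] [T.Finite] (i : S ⟶ T) {n : ℕ} (g : Δ[n] ⟶ S)
    (X : SimplicialObject C) : restr i X ≫ evHom g X = evHom (g ≫ i) X := by
  rw [evHom, restr_ev]; rfl

lemma evHom_ofHom {S T : SSet.{0}} [S.Finite] [T.Finite] {n : ℕ} (g : Δ[n] ⟶ T) (h : S ⟶ Δ[n])
    (X : SimplicialObject C) : evHom g X ≫ ofHom h X = restr (h ≫ g) X :=
  hom_ext fun m x => by
    rw [Category.assoc, ofHom_ev, restr_ev, evHom, ev_map]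
    obtain ⟨z, rfl⟩ := SSet.yonedaEquiv.symm.surjective g
    rw [Equiv.apply_symm_apply]
    rfl

lemma evHom_map {T : SSet.{0}} [T.Finite] {n m : ℕ} (g : Δ[n] ⟶ T) (h : ⦋m⦌ ⟶ ⦋n⦌)
    (X : SimplicialObject C) : evHom g X ≫ X.map h.op = evHom (SSet.stdSimplex.map h ≫ g) X := by
  rw [evHom, ev_map, SSet.yonedaEquiv_naturality]
  rfl

lemma ofHom_evHom {T : SSet.{0}} [T.Finite] {n m : ℕ} (h : T ⟶ Δ[n]) (g : ⦋m⦌ ⟶ ⦋n⦌)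
    (i : Δ[m] ⟶ T) (hg : i ≫ h = SSet.stdSimplex.map g) (X : SimplicialObject C) :
    ofHom h X ≫ evHom i X = X.map g.op := by
  rw [evHom, ofHom_ev, ← SSet.yonedaEquiv_comp, hg, SSet.yonedaEquiv_map,
    Equiv.apply_symm_apply]

/-- The Yoneda isomorphism between `Map Δ[n] X` and `X_n`. -/
lemma isIso_evHom (n : ℕ) (X : SimplicialObject C) : IsIso (evHom (𝟙 Δ[n]) X) :=
  ⟨ofHom (𝟙 _) X, by rw [evHom_ofHom, Category.comp_id, restr_id], by
    refine (ofHom_evHom (𝟙 Δ[n]) (𝟙 ⦋n⦌) (𝟙 Δ[n])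
      (((Category.id_comp _).trans (SSet.stdSimplex.map_id ⦋n⦌).symm)) X).trans ?_
    rw [op_id, X.map_id]⟩

/-- `Map` takes a gluing of two simplicial sets along a common simplicial subset to a pullback. -/
lemma isPullback_restr {R A B K : SSet.{0}} [R.Finite] [A.Finite] [B.Finite] [K.Finite]
    (a : R ⟶ A) (b : R ⟶ B) (c : A ⟶ K) (d : B ⟶ K) (w : a ≫ c = b ≫ d)
    (hc : ∀ m, Function.Injective (c.app m)) (hd : ∀ m, Function.Injective (d.app m))
    (hcover : ∀ m z, (∃ x, c.app m x = z) ∨ ∃ y, d.app m y = z)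
    (hmeet : ∀ m x y, c.app m x = d.app m y → ∃ r, a.app m r = x ∧ b.app m r = y)
    (X : SimplicialObject C) :
    IsPullback (restr c X) (restr d X) (restr a X) (restr b X) := by
  refine isPullback_of_elements (by rw [← restr_comp, ← restr_comp, w]) ?_ ?_
  · intro Z s t hst
    have key : ∀ m x y, c.app m x = d.app m y → s ≫ ev X x = t ≫ ev X y := by
      intro m x y hxy
      obtain ⟨r, rfl, rfl⟩ := hmeet m x y hxy
      rw [← restr_ev, ← restr_ev, ← Category.assoc, hst, Category.assoc]
    -- The value at `z` is specified against all preimages in both pieces, so that the chosen family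
    -- is compatible whichever piece a simplex is read in.
    have ex : ∀ m z, ∃ l : Z ⟶ X.obj m, (∀ x, c.app m x = z → l = s ≫ ev X x) ∧
        ∀ y, d.app m y = z → l = t ≫ ev X y := by
      intro m z
      rcases hcover m z with ⟨x, rfl⟩ | ⟨y, rfl⟩
      · exact ⟨s ≫ ev X x, fun x' hx => by rw [hc m hx], fun y hy => key m x y hy.symm⟩
      · exact ⟨t ≫ ev X y, fun x hx => (key m x y hx).symm, fun y' hy => by rw [hd m hy]⟩
    choose l hl hl' using ex
    refine ⟨lift l ?_, hom_ext fun m x => ?_, hom_ext fun m y => ?_⟩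
    · intro m m' g z
      rcases hcover m z with ⟨x, rfl⟩ | ⟨y, rfl⟩
      · rw [hl m _ x rfl, hl m' _ (A.map g x) (by rw [NatTrans.naturality_apply]),
          Category.assoc, ev_map]
      · rw [hl' m _ y rfl, hl' m' _ (B.map g y) (by rw [NatTrans.naturality_apply]),
          Category.assoc, ev_map]
    · rw [Category.assoc, restr_ev, lift_ev, hl m _ x rfl]
    · rw [Category.assoc, restr_ev, lift_ev, hl' m _ y rfl]
  · intro Z l l' h₁ h₂
    refine hom_ext fun m z => ?_
    rcases hcover m z with ⟨x, rfl⟩ | ⟨y, rfl⟩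
    · rw [← restr_ev, ← Category.assoc, h₁, Category.assoc]
    · rw [← restr_ev, ← Category.assoc, h₂, Category.assoc]

/-- `Map T` preserves pullbacks. -/
lemma isPullback_post (T : SSet.{0}) [T.Finite] {W X Y Z : SimplicialObject C} {a : W ⟶ X}
    {b : W ⟶ Y} {c : X ⟶ Z} {d : Y ⟶ Z} (h : IsPullback a b c d) :
    IsPullback (post T a) (post T b) (post T c) (post T d) := by
  have hm : ∀ m, IsPullback (a.app m) (b.app m) (c.app m) (d.app m) := fun m =>
    h.map ((evaluation _ _).obj m)
  refine isPullback_of_elements (by rw [← post_comp, ← post_comp, h.w]) ?_ ?_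
  · intro A s t hst
    have hst' : ∀ (m : SimplexCategoryᵒᵖ) (x : T.obj m),
        (s ≫ ev X x) ≫ c.app m = (t ≫ ev Y x) ≫ d.app m := by
      intro m x
      rw [Category.assoc, Category.assoc, ← post_ev, ← post_ev, ← Category.assoc, hst,
        Category.assoc]
    refine ⟨lift (fun m x => (hm m).lift (s ≫ ev X x) (t ≫ ev Y x) (hst' m x)) ?_,
      hom_ext fun m x => ?_, hom_ext fun m x => ?_⟩
    · intro m m' g x
      refine (hm m').hom_ext ?_ ?_
      · rw [Category.assoc, NatTrans.naturality, IsPullback.lift_fst, ← Category.assoc,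
          IsPullback.lift_fst, Category.assoc, ev_map]
      · rw [Category.assoc, NatTrans.naturality, IsPullback.lift_snd, ← Category.assoc,
          IsPullback.lift_snd, Category.assoc, ev_map]
    · rw [Category.assoc, post_ev, ← Category.assoc, lift_ev, IsPullback.lift_fst]
    · rw [Category.assoc, post_ev, ← Category.assoc, lift_ev, IsPullback.lift_snd]
  · intro A l l' h₁ h₂
    refine hom_ext fun m x => (hm m).hom_ext ?_ ?_
    · rw [Category.assoc, Category.assoc, ← post_ev, ← Category.assoc, h₁, Category.assoc]
    · rw [Category.assoc, Category.assoc, ← post_ev, ← Category.assoc, h₂, Category.assoc]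

end Map

/-! ### Path spaces and the exponential law. -/

namespace P

variable {n : ℕ} {X : SimplicialObject C}

/-- Evaluation of a point of `(P_n X)_m` at the simplex `(id, y)` of `Δ[m] × Δ[n]`. -/
noncomputable def ev (X : SimplicialObject C) {m : SimplexCategoryᵒᵖ}
    (y : (Δ[n] : SSet.{0}).obj m) : (P n X).obj m ⟶ X.obj m :=
  Map.ev (T := SSet.stdSimplex.{0}.obj m.unop ⊗ Δ[n]) X
    (SSet.stdSimplex.objEquiv.symm (𝟙 m.unop), y)

lemma map_ev {m m' : SimplexCategoryᵒᵖ} (g : m ⟶ m') (y : (Δ[n] : SSet.{0}).obj m') :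
    (P n X).map g ≫ ev X y = Map.ev (T := SSet.stdSimplex.{0}.obj m.unop ⊗ Δ[n]) X
      (SSet.stdSimplex.objEquiv.symm g.unop, y) :=
  (Map.restr_ev _ _ _).trans (congrArg (Map.ev X)
    (Prod.ext (SSet.stdSimplex.objEquiv.injective (Category.id_comp g.unop)) rfl))

lemma ev_map {m m' : SimplexCategoryᵒᵖ} (g : m ⟶ m') (y : (Δ[n] : SSet.{0}).obj m) :
    ev X y ≫ X.map g = (P n X).map g ≫ ev X ((Δ[n] : SSet.{0}).map g y) := by
  rw [map_ev]
  refine (Map.ev_map X _ _).trans (congrArg (Map.ev X)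
    (Prod.ext (SSet.stdSimplex.objEquiv.injective (Category.comp_id g.unop)) rfl))

/-- Every simplex `(g, y)` of `Δ[m] × Δ[n]` is the image of the simplex `(id, y)` under the map
induced by `g`. -/
lemma hom_ext {A : C} {m : SimplexCategoryᵒᵖ} {a b : A ⟶ (P n X).obj m}
    (h : ∀ (m' : SimplexCategoryᵒᵖ) (g : m ⟶ m') (y : (Δ[n] : SSet.{0}).obj m'),
      a ≫ (P n X).map g ≫ ev X y = b ≫ (P n X).map g ≫ ev X y) : a = b :=
  Map.hom_ext fun m' z => by
    have := h m' (SSet.stdSimplex.objEquiv z.1).op z.2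
    rw [map_ev] at this
    exact this

end P

namespace Map

/-- The point of `(P_n X)_m` that a point of `Map (S × Δ[n]) X` assigns to a simplex of `S`. -/
noncomputable def curryEv {S : SSet.{0}} [S.Finite] (n : ℕ) (X : SimplicialObject C)
    {m : SimplexCategoryᵒᵖ} (x : S.obj m) : Map (S ⊗ Δ[n]) X ⟶ (P n X).obj m :=
  restr (T := S ⊗ Δ[n]) (SSet.yonedaEquiv.symm x ▷ Δ[n]) X

lemma curryEv_map {S : SSet.{0}} [S.Finite] (n : ℕ) (X : SimplicialObject C)
    {m m' : SimplexCategoryᵒᵖ} (x : S.obj m) (g : m ⟶ m') :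
    curryEv n X x ≫ (P n X).map g = curryEv n X (S.map g x) := by
  refine (restr_comp _ _ _).symm.trans ?_
  rw [← comp_whiskerRight]
  exact congrArg (fun h => restr (h ▷ Δ[n]) X) (SSet.yonedaEquiv_symm_naturality_left g.unop x)

lemma curryEv_ev {S : SSet.{0}} [S.Finite] (n : ℕ) (X : SimplicialObject C)
    {m : SimplexCategoryᵒᵖ} (x : (S ⊗ Δ[n]).obj m) :
    curryEv n X x.1 ≫ P.ev X x.2 = ev X x :=
  (restr_ev _ _ _).trans
    (congrArg (ev X) (Prod.ext (SSet.yonedaEquiv.apply_symm_apply x.1) rfl))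

/-- The point of `Map (S × Δ[n]) X` that corresponds to a point of `Map S (P_n X)`. -/
noncomputable def uncurry (S : SSet.{0}) [S.Finite] (n : ℕ) (X : SimplicialObject C) :
    Map S (P n X) ⟶ Map (S ⊗ Δ[n]) X :=
  lift (fun m x => ev (P n X) x.1 ≫ P.ev X x.2) fun m m' g x => by
    rw [Category.assoc, P.ev_map, ← Category.assoc, ev_map]
    rfl

lemma uncurry_ev (S : SSet.{0}) [S.Finite] (n : ℕ) (X : SimplicialObject C)
    {m : SimplexCategoryᵒᵖ} (x : (S ⊗ Δ[n]).obj m) :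
    uncurry S n X ≫ ev X x = ev (P n X) x.1 ≫ P.ev X x.2 :=
  lift_ev _ _ _

lemma uncurry_curryEv (S : SSet.{0}) [S.Finite] (n : ℕ) (X : SimplicialObject C)
    {m : SimplexCategoryᵒᵖ} (x : S.obj m) : uncurry S n X ≫ curryEv n X x = ev (P n X) x :=
  P.hom_ext fun m' g y => by
    have h := curryEv_ev n X (m := m') (S := S) (S.map g x, y)
    have h' := uncurry_ev S n X (m := m') (S.map g x, y)
    rw [← h, ← ev_map (P n X) g x, ← curryEv_map, Category.assoc, Category.assoc] at h'
    rw [Category.assoc]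
    exact h'

/-- The exponential law `Map (S × Δ[n]) X ≅ Map S (P_n X)`. -/
noncomputable def curry (S : SSet.{0}) [S.Finite] (n : ℕ) (X : SimplicialObject C) :
    Map (S ⊗ Δ[n]) X ≅ Map S (P n X) where
  hom := lift (X := P n X) (fun m x => curryEv n X x) fun m m' g x => curryEv_map n X x g
  inv := uncurry S n X
  hom_inv_id := hom_ext fun m x => by
    rw [Category.assoc, uncurry_ev, ← Category.assoc, lift_ev, Category.id_comp, curryEv_ev]
  inv_hom_id := hom_ext fun m x => by
    rw [Category.assoc, lift_ev, Category.id_comp, uncurry_curryEv]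

lemma curry_hom_post_evVertex (S : SSet.{0}) [S.Finite] (n : ℕ) (i : Fin (n + 1))
    (X : SimplicialObject C) (j : S ⟶ S ⊗ Δ[n])
    (hj : ∀ m x, j.app m x = (x, SSet.stdSimplex.const n i m)) :
    (curry S n X).hom ≫ post S (P.evVertex n i X) = restr j X :=
  hom_ext fun m x => by
    have h : (curry S n X).hom ≫ ev (P n X) x = curryEv n X x :=
      lift_ev _ (fun m m' g x => curryEv_map n X x g) x
    rw [Category.assoc, post_ev, ← Category.assoc, h, restr_ev, hj]
    exact curryEv_ev n X (m := m) (S := S) (x, SSet.stdSimplex.const n i m)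

end Map
end

/-! ### Simplicial subsets of the prism -/

namespace Prism

/-- The vertices of a simplex of the prism `Δ[n] × Δ[1]`. -/
def verts {n : ℕ} {m : SimplexCategoryᵒᵖ} (z : (Δ[n] ⊗ Δ[1] : SSet.{0}).obj m) :
    Fin (m.unop.len + 1) →o Fin (n + 1) × Fin 2 :=
  (SSet.stdSimplex.asOrderHom z.1).prod (SSet.stdSimplex.asOrderHom z.2)

/-- The prism is the nerve of the poset `[n] × [1]`; this reduces equalities of simplices to
equalities of vertices. -/
lemma verts_injective {n : ℕ} {m : SimplexCategoryᵒᵖ} :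
    Function.Injective (verts (n := n) (m := m)) := fun z w h => by
  have h₁ : ∀ a, verts z a = verts w a := fun a => by rw [h]
  refine Prod.ext (SSet.stdSimplex.objEquiv.injective ?_) (SSet.stdSimplex.objEquiv.injective ?_)
  · ext a : 3
    exact congrArg Prod.fst (h₁ a)
  · ext a : 3
    exact congrArg Prod.snd (h₁ a)

/-- The simplices of the prism whose sets of vertices belong to a given family. -/
def flag {n : ℕ} (p : LowerSet (Set (Fin (n + 1) × Fin 2))) :
    (Δ[n] ⊗ Δ[1] : SSet.{0}).Subcomplex where
  obj _ := {z | Set.range (verts z) ∈ p}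
  map g z hz := p.lower (Set.range_comp_subset_range g.unop.toOrderHom (verts z)) hz

lemma mem_flag {n : ℕ} {p : LowerSet (Set (Fin (n + 1) × Fin 2))} {m : SimplexCategoryᵒᵖ}
    {z : (Δ[n] ⊗ Δ[1] : SSet.{0}).obj m} : z ∈ (flag p).obj m ↔ Set.range (verts z) ∈ p :=
  Iff.rfl

lemma flag_mono {n : ℕ} {p q : LowerSet (Set (Fin (n + 1) × Fin 2))} (h : p ≤ q) :
    flag p ≤ flag q :=
  fun _ _ hz => mem_flag.2 (h (mem_flag.1 hz))

/-- The simplex of the prism with given vertices. -/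
def simplex {n m : ℕ} (φ : Fin (m + 1) →o Fin (n + 1) × Fin 2) :
    (Δ[m] : SSet.{0}) ⟶ Δ[n] ⊗ Δ[1] :=
  SSet.yonedaEquiv.symm (SSet.stdSimplex.objMk (OrderHom.fst.comp φ),
    SSet.stdSimplex.objMk (OrderHom.snd.comp φ))

lemma verts_simplex {n m : ℕ} (φ : Fin (m + 1) →o Fin (n + 1) × Fin 2) {l : SimplexCategoryᵒᵖ}
    (s : (Δ[m] : SSet.{0}).obj l) :
    verts ((simplex φ).app l s) = φ.comp (SSet.stdSimplex.asOrderHom s) := rfl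

lemma simplex_injective {n m : ℕ} (φ : Fin (m + 1) →o Fin (n + 1) × Fin 2)
    (hφ : Function.Injective φ) (l : SimplexCategoryᵒᵖ) :
    Function.Injective ((simplex φ).app l) := fun s t h => by
  have h₁ : ∀ a, φ (SSet.stdSimplex.asOrderHom s a) = φ (SSet.stdSimplex.asOrderHom t a) :=
    fun a => DFunLike.congr_fun (congrArg verts h) a
  refine SSet.stdSimplex.objEquiv.injective ?_
  ext a : 3
  exact hφ (h₁ a)

/-- An injective monotone map out of a linear order reflects the order, so the vertices of `z` lift
to a monotone sequence. -/
lemma exists_simplex {n m : ℕ} (φ : Fin (m + 1) →o Fin (n + 1) × Fin 2)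
    (hφ : Function.Injective φ) {l : SimplexCategoryᵒᵖ} (z : (Δ[n] ⊗ Δ[1] : SSet.{0}).obj l)
    (hz : Set.range (verts z) ⊆ Set.range φ) : ∃ s, (simplex φ).app l s = z := by
  choose s hs using fun a => hz ⟨a, rfl⟩
  have hmono : Monotone s := by
    intro a b hab
    by_contra! h
    have h₁ := (verts z).monotone hab
    rw [← hs, ← hs] at h₁
    exact h.ne (hφ (le_antisymm (φ.monotone h.le) h₁))
  refine ⟨SSet.stdSimplex.objMk ⟨s, hmono⟩, verts_injective ?_⟩
  rw [verts_simplex]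
  exact OrderHom.ext _ _ (funext hs)

/-- The inclusion of a simplex into a simplicial subset of the prism. -/
def simplexToFlag {n m : ℕ} (p : LowerSet (Set (Fin (n + 1) × Fin 2)))
    (φ : Fin (m + 1) →o Fin (n + 1) × Fin 2) (h : Set.range φ ∈ p) :
    (Δ[m] : SSet.{0}) ⟶ (flag p : SSet.{0}) :=
  SSet.Subcomplex.lift (simplex φ) (by
    rintro l _ ⟨s, rfl⟩
    exact mem_flag.2 (p.lower (Set.range_comp_subset_range (SSet.stdSimplex.asOrderHom s) φ) h))

/-- The inclusion of a horn into a simplicial subset of the prism. -/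
def hornToFlag {n m : ℕ} (p : LowerSet (Set (Fin (n + 1) × Fin 2)))
    (φ : Fin (m + 1) →o Fin (n + 1) × Fin 2) (i : Fin (m + 1))
    (h : ∀ k, k ≠ i → φ '' {k}ᶜ ∈ p) :
    (SSet.horn m i : SSet.{0}) ⟶ (flag p : SSet.{0}) :=
  SSet.Subcomplex.lift ((SSet.horn m i).ι ≫ simplex φ) (by
    rintro l _ ⟨⟨s, hs⟩, rfl⟩
    obtain ⟨k, hk⟩ := (Set.ne_univ_iff_exists_notMem _).1 hs
    rw [Set.mem_union, not_or] at hk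
    refine mem_flag.2 (p.lower ?_ (h k hk.2))
    rintro _ ⟨a, rfl⟩
    exact ⟨_, fun h => hk.1 ⟨a, h⟩, rfl⟩)

/-- The inclusion of the boundary of a simplex into a simplicial subset of the prism. -/
def boundaryToFlag {n m : ℕ} (p : LowerSet (Set (Fin (n + 1) × Fin 2)))
    (φ : Fin (m + 1) →o Fin (n + 1) × Fin 2) (h : ∀ k, φ '' {k}ᶜ ∈ p) :
    (SSet.boundary m : SSet.{0}) ⟶ (flag p : SSet.{0}) :=
  SSet.Subcomplex.lift ((SSet.boundary m).ι ≫ simplex φ) (by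
    rintro l _ ⟨⟨s, hs⟩, rfl⟩
    obtain ⟨k, hk⟩ := not_forall.1 hs
    refine mem_flag.2 (p.lower ?_ (h k))
    rintro _ ⟨a, rfl⟩
    exact ⟨_, fun h => hk ⟨a, h⟩, rfl⟩)

end Prism

/-! ### Attaching simplices and pullbacks of mapping spaces. -/

section

variable {C : Type u} [Category.{v} C] [HasFiniteLimits C]

/-- Attaching a simplex along a simplicial subset of it. -/
lemma Map.isPullback_attach {A K : SSet.{0}} [A.Finite] [K.Finite] {m : ℕ}
    (S : (Δ[m] : SSet.{0}).Subcomplex) (c : A ⟶ K) (σ : Δ[m] ⟶ K) (τ : (S : SSet.{0}) ⟶ A)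
    (w : τ ≫ c = S.ι ≫ σ)
    (hc : ∀ m, Function.Injective (c.app m)) (hσ : ∀ m, Function.Injective (σ.app m))
    (hcover : ∀ m z, (∃ x, c.app m x = z) ∨ ∃ y, σ.app m y = z)
    (hmeet : ∀ l x y, c.app l x = σ.app l y → y ∈ S.obj l) (X : SimplicialObject C) :
    IsPullback (restr c X) (evHom σ X) (restr τ X) (ofSimplex S X) := by
  have h := isPullback_restr τ S.ι c σ w hc hσ hcover (fun l x y hxy =>
    ⟨⟨y, hmeet l x y hxy⟩, hc l (by
      have := congrArg (fun f => f.app l ⟨y, hmeet l x y hxy⟩) w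
      exact this.trans hxy.symm), rfl⟩) X
  -- Replace `Map Δ[m] X` by `X_m` by pasting with the Yoneda isomorphism.
  have := isIso_evHom m X
  have h' : IsPullback (restr S.ι X) (evHom (𝟙 Δ[m]) X) (𝟙 _)
      (ofSimplex S X) := IsPullback.of_vert_isIso ⟨by
    rw [ofSimplex_eq, evHom_ofHom, Category.comp_id]; rfl⟩
  have h'' := h.paste_vert h'
  rw [Category.comp_id, restr_evHom] at h''
  exact h''

/-- By `hp` and `hi` the simplex `φ` meets `flag p` exactly in its `i`th horn: a simplex outside the
horn has all vertices except possibly the `i`th, so its presence in `flag p` would put the `i`th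
facet there. Chains suffice in `hcover` because vertex sets of simplices are chains. -/
lemma Prism.isPullback_flag {n m : ℕ} {p q : LowerSet (Set (Fin (n + 1) × Fin 2))} (hpq : p ≤ q)
    (φ : Fin (m + 1) →o Fin (n + 1) × Fin 2) (hφ : Function.Injective φ) (i : Fin (m + 1))
    (hq : Set.range φ ∈ q) (hp : ∀ k, k ≠ i → φ '' {k}ᶜ ∈ p) (hi : φ '' {i}ᶜ ∉ p)
    (hcover : ∀ c ∈ q, IsChain (· ≤ ·) c → c ∈ p ∨ c ⊆ Set.range φ) (X : SimplicialObject C) :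
    IsPullback (Map.restr (SSet.Subcomplex.homOfLE (flag_mono hpq)) X)
      (Map.evHom (simplexToFlag q φ hq) X) (Map.restr (hornToFlag p φ i hp) X)
      (Map.ofSimplex (SSet.horn m i) X) := by
  refine Map.isPullback_attach (SSet.horn m i) (SSet.Subcomplex.homOfLE (flag_mono hpq)) (simplexToFlag q φ hq)
    (hornToFlag p φ i hp) rfl (fun l x y hxy => ?_) (fun l x y hxy => ?_)
    (fun l z => ?_) (fun l x y hxy => ?_) X
  · have h := congrArg Subtype.val hxy
    exact Subtype.ext h
  · exact simplex_injective φ hφ l (congrArg Subtype.val hxy)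
  · have hz : IsChain (· ≤ ·) (Set.range (verts z.1)) := by
      rintro _ ⟨a, rfl⟩ _ ⟨b, rfl⟩ _
      exact (le_total a b).imp (fun h => (verts z.1).monotone h) fun h => (verts z.1).monotone h
    refine (hcover _ z.2 hz).imp (fun h => ⟨⟨z.1, h⟩, rfl⟩) fun h => ?_
    obtain ⟨s, hs⟩ := exists_simplex φ hφ z.1 h
    exact ⟨s, Subtype.ext hs⟩
  · intro hy
    have hx : Set.range (verts x.1) ∈ p := x.2
    have hxy' : x.1 = (simplex φ).app l y := congrArg Subtype.val hxy
    rw [hxy', verts_simplex] at hx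
    refine hi (p.lower ?_ hx)
    rintro _ ⟨k, hk, rfl⟩
    rcases Set.eq_univ_iff_forall.1 hy k with ⟨a, ha⟩ | h
    · exact ⟨a, congrArg φ ha⟩
    · exact absurd h hk

end

/-! ### Shuffles and two filtrations of the prism. -/

namespace Prism

/-- The vertices `(0, 0), …, (j, 0), (j, 1), …, (n, 1)` of a simplex of maximal dimension of the
prism `Δ[n] × Δ[1]`. -/
def shuffle {n : ℕ} (j : Fin (n + 1)) : Fin (n + 2) →o Fin (n + 1) × Fin 2 where
  toFun k := (j.predAbove k, if (k : ℕ) ≤ j then 0 else 1)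
  monotone' a b h := by
    refine ⟨Fin.predAbove_right_monotone j h, ?_⟩
    have : (a : ℕ) ≤ b := h
    dsimp only
    split_ifs <;> omega

lemma coe_fst_shuffle {n : ℕ} (j : Fin (n + 1)) (k : Fin (n + 2)) :
    ((shuffle j k).1 : ℕ) = if (k : ℕ) ≤ j then (k : ℕ) else k - 1 := by
  change ((j.predAbove k : Fin (n + 1)) : ℕ) = _
  split_ifs with h
  · rw [Fin.predAbove_of_le_castSucc j k h]; rfl
  · rw [Fin.predAbove_of_castSucc_lt j k (not_le.1 h)]; rfl

lemma coe_snd_shuffle {n : ℕ} (j : Fin (n + 1)) (k : Fin (n + 2)) :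
    ((shuffle j k).2 : ℕ) = if (k : ℕ) ≤ j then 0 else 1 := by
  change (((if (k : ℕ) ≤ j then 0 else 1 : Fin 2)) : ℕ) = _
  split_ifs <;> rfl

lemma shuffle_injective {n : ℕ} (j : Fin (n + 1)) : Function.Injective (shuffle j) := by
  intro a b h
  have h₁ := coe_fst_shuffle j a
  have h₂ := coe_snd_shuffle j a
  have h₃ := coe_fst_shuffle j b
  have h₄ := coe_snd_shuffle j b
  rw [h] at h₁ h₂
  apply Fin.ext
  split_ifs at * <;> omega

lemma mem_range_shuffle {n : ℕ} (j : Fin (n + 1)) (v : Fin (n + 1) × Fin 2) :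
    v ∈ Set.range (shuffle j) ↔
      ((v.2 : ℕ) = 0 → (v.1 : ℕ) ≤ j) ∧ ((v.2 : ℕ) = 1 → (j : ℕ) ≤ v.1) := by
  constructor
  · rintro ⟨a, rfl⟩
    rw [coe_fst_shuffle, coe_snd_shuffle]
    split_ifs <;> refine ⟨fun _ => ?_, fun _ => ?_⟩ <;> first | omega | contradiction
  · rintro ⟨h₁, h₂⟩
    have h₃ := v.1.isLt
    have h₄ := v.2.isLt
    -- Each step of a shuffle raises exactly one coordinate, so the position of a vertex is the sum
    -- of its coordinates.
    refine ⟨⟨v.1 + v.2, by omega⟩, Prod.ext (Fin.ext ?_) (Fin.ext ?_)⟩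
    · rw [coe_fst_shuffle]
      dsimp only
      split_ifs <;> omega
    · rw [coe_snd_shuffle]
      dsimp only
      split_ifs <;> omega

/-- In a chain every vertex at height 1 lies above the vertex of `h₂`, so its first coordinate is at
least `j`. -/
lemma subset_range_shuffle {n : ℕ} (j : Fin (n + 1)) {c : Set (Fin (n + 1) × Fin 2)}
    (hc : IsChain (· ≤ ·) c) (h₁ : ∀ v ∈ c, (v.2 : ℕ) = 0 → (v.1 : ℕ) ≤ j)
    (h₂ : ∃ v ∈ c, (v.2 : ℕ) = 0 ∧ (j : ℕ) ≤ v.1) : c ⊆ Set.range (shuffle j) := by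
  refine fun w hw => (mem_range_shuffle j w).2 ⟨h₁ w hw, fun h₃ => ?_⟩
  obtain ⟨v, hv, h₄, h₅⟩ := h₂
  rcases hc.total hv hw with h₆ | h₆
  · exact h₅.trans h₆.1
  · have : (w.2 : ℕ) ≤ v.2 := h₆.2
    omega

/-- The simplices of the prism that lie over the boundary of `Δ[n]`, or do not have a vertex
`(x, 0)` with `j ≤ x`. -/
def lower (n j : ℕ) : LowerSet (Set (Fin (n + 1) × Fin 2)) where
  carrier := {c | (∃ k, ∀ v ∈ c, v.1 ≠ k) ∨ ∀ v ∈ c, (v.2 : ℕ) = 0 → (v.1 : ℕ) < j}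
  lower' _ _ hcd := Or.imp (fun ⟨k, hk⟩ => ⟨k, fun v hv => hk v (hcd hv)⟩)
    fun h v hv => h v (hcd hv)

lemma mem_lower {n j : ℕ} {c : Set (Fin (n + 1) × Fin 2)} : c ∈ lower n j ↔
    (∃ k, ∀ v ∈ c, v.1 ≠ k) ∨ ∀ v ∈ c, (v.2 : ℕ) = 0 → (v.1 : ℕ) < j :=
  Iff.rfl

lemma lower_mono (n : ℕ) {i j : ℕ} (h : i ≤ j) : lower n i ≤ lower n j :=
  fun _ => Or.imp_right fun hc v hv hv' => (hc v hv hv').trans_le h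

lemma shuffle_mem_lower {n : ℕ} (j : Fin (n + 1)) :
    Set.range (shuffle j) ∈ lower n (j + 1) :=
  Or.inr fun v hv h => by
    have := ((mem_range_shuffle j v).1 hv).1 h
    omega

/-- Without `(j, 0)`, only vertices `(x, 0)` with `x < j` remain at height 0. Any other vertex
except `(j, 1)` is alone over its first coordinate, so dropping it leaves a facet over the boundary.
-/
lemma shuffle_compl_mem_lower {n : ℕ} (j : Fin (n + 1)) (k : Fin (n + 2)) (hk : k ≠ j.succ) :
    shuffle j '' {k}ᶜ ∈ lower n j := by
  have hk' : (k : ℕ) ≠ j + 1 := fun h => hk (Fin.ext h)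
  by_cases hkj : (k : ℕ) = j
  · right
    rintro _ ⟨a, ha, rfl⟩ h
    have ha' : (a : ℕ) ≠ k := fun h => ha (Fin.ext h)
    rw [coe_snd_shuffle] at h
    rw [coe_fst_shuffle]
    split_ifs at *
    omega
  · left
    refine ⟨(shuffle j k).1, ?_⟩
    rintro _ ⟨a, ha, rfl⟩ h
    have ha' : (a : ℕ) ≠ k := fun h => ha (Fin.ext h)
    have h' := congrArg Fin.val h
    rw [coe_fst_shuffle, coe_fst_shuffle] at h'
    split_ifs at * <;> omega

/-- The vertices other than `(j, 1)` of the `j`th shuffle lie over all of `Δ[n]`. -/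
lemma exists_mem_shuffle_compl {n : ℕ} (j : Fin (n + 1)) (k : Fin (n + 1)) :
    ∃ v ∈ shuffle j '' {j.succ}ᶜ, v.1 = k := by
  by_cases h : (k : ℕ) ≤ j
  · refine ⟨_, ⟨k.castSucc, fun h' => ?_, rfl⟩, Fin.ext ?_⟩
    · have := congrArg Fin.val h'
      simp at this
      omega
    · rw [coe_fst_shuffle, if_pos (by simpa using h)]
      rfl
  · refine ⟨_, ⟨k.succ, fun h' => ?_, rfl⟩, Fin.ext ?_⟩
    · have := congrArg Fin.val h'
      simp at this
      omega
    · rw [coe_fst_shuffle, if_neg (by simp; omega)]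
      rfl

lemma mem_shuffle_compl {n : ℕ} (j : Fin (n + 1)) : (j, 0) ∈ shuffle j '' {j.succ}ᶜ := by
  refine ⟨j.castSucc, fun h => ?_, Prod.ext (Fin.ext ?_) (Fin.ext ?_)⟩
  · have := congrArg Fin.val h
    simp at this
  · rw [coe_fst_shuffle, if_pos (by simp)]; rfl
  · rw [coe_snd_shuffle, if_pos (by simp)]; rfl

lemma shuffle_compl_notMem_lower {n : ℕ} (j : Fin (n + 1)) :
    shuffle j '' {j.succ}ᶜ ∉ lower n j := by
  rintro (⟨k, hk⟩ | h)
  · obtain ⟨v, hv, hvk⟩ := exists_mem_shuffle_compl j k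
    exact hk v hv hvk
  · exact lt_irrefl _ (h _ (mem_shuffle_compl j) rfl)

lemma lower_cover {n : ℕ} (j : Fin (n + 1)) {c : Set (Fin (n + 1) × Fin 2)}
    (hc : c ∈ lower n (j + 1)) (hc' : IsChain (· ≤ ·) c) :
    c ∈ lower n j ∨ c ⊆ Set.range (shuffle j) := by
  refine or_iff_not_imp_left.2 fun h => ?_
  rw [mem_lower, not_or] at h
  have h₁ := h.2
  push Not at h₁
  exact subset_range_shuffle j hc' (fun v hv hv' =>
    Nat.lt_succ_iff.1 ((mem_lower.1 hc).resolve_left h.1 v hv hv')) h₁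

/-- The simplices of the prism over `Δ[n + 1]` that lie over the last horn, or have all vertices
of the form `(x, 0)`, or do not have a vertex `(x, 0)` with `j ≤ x`. -/
def lowerHorn (n j : ℕ) : LowerSet (Set (Fin (n + 2) × Fin 2)) where
  carrier := {c | (∃ k : Fin (n + 1), ∀ v ∈ c, v.1 ≠ k.castSucc) ∨ (∀ v ∈ c, (v.2 : ℕ) = 0) ∨
    ∀ v ∈ c, (v.2 : ℕ) = 0 → (v.1 : ℕ) < j}
  lower' _ _ hcd := Or.imp (fun ⟨k, hk⟩ => ⟨k, fun v hv => hk v (hcd hv)⟩)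
    (Or.imp (fun h v hv => h v (hcd hv)) fun h v hv => h v (hcd hv))

lemma mem_lowerHorn {n j : ℕ} {c : Set (Fin (n + 2) × Fin 2)} : c ∈ lowerHorn n j ↔
    (∃ k : Fin (n + 1), ∀ v ∈ c, v.1 ≠ k.castSucc) ∨ (∀ v ∈ c, (v.2 : ℕ) = 0) ∨
      ∀ v ∈ c, (v.2 : ℕ) = 0 → (v.1 : ℕ) < j :=
  Iff.rfl

/-- The simplices of `lowerHorn n j`, together with those over the last face of `Δ[n + 1]` that
do not have a vertex `(x, 0)` with `j + 1 ≤ x`. -/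
def lowerHornFace (n j : ℕ) : LowerSet (Set (Fin (n + 2) × Fin 2)) where
  carrier := {c | c ∈ lowerHorn n j ∨ (∀ v ∈ c, v.1 ≠ Fin.last _) ∧
    ∀ v ∈ c, (v.2 : ℕ) = 0 → (v.1 : ℕ) < j + 1}
  lower' _ _ hcd := Or.imp ((lowerHorn n j).lower hcd)
    (And.imp (fun h v hv => h v (hcd hv)) fun h v hv => h v (hcd hv))

/-- The simplices of `lowerHorn n n`, together with those which do not have a vertex `(x, 1)` with
`x ≤ n`. -/
def lowerHornLast (n : ℕ) : LowerSet (Set (Fin (n + 2) × Fin 2)) where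
  carrier := {c | c ∈ lowerHorn n n ∨ ∀ v ∈ c, (v.2 : ℕ) = 1 → v.1 = Fin.last _}
  lower' _ _ hcd := Or.imp ((lowerHorn n n).lower hcd) fun h v hv => h v (hcd hv)

lemma mem_lowerHornLast {n : ℕ} {c : Set (Fin (n + 2) × Fin 2)} : c ∈ lowerHornLast n ↔
    c ∈ lowerHorn n n ∨ ∀ v ∈ c, (v.2 : ℕ) = 1 → v.1 = Fin.last _ :=
  Iff.rfl

/-- The shuffle of the prism over the last face of `Δ[n + 1]`. -/
def faceShuffle {n : ℕ} (j : Fin (n + 1)) : Fin (n + 2) →o Fin (n + 2) × Fin 2 where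
  toFun k := ((shuffle j k).1.castSucc, (shuffle j k).2)
  monotone' _ _ h := ⟨((shuffle j).monotone h).1, ((shuffle j).monotone h).2⟩

lemma faceShuffle_injective {n : ℕ} (j : Fin (n + 1)) : Function.Injective (faceShuffle j) :=
  fun _ _ h => shuffle_injective j (Prod.ext (Fin.castSucc_injective _ (congrArg Prod.fst h))
    (congrArg Prod.snd h :))

lemma lowerHorn_le_face (n j : ℕ) : lowerHorn n j ≤ lowerHornFace n j := fun _ => Or.inl

lemma lowerHornFace_le (n j : ℕ) : lowerHornFace n j ≤ lowerHorn n (j + 1) := by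
  rintro c ((h | h | h) | h)
  · exact Or.inl h
  · exact Or.inr (Or.inl h)
  · exact Or.inr (Or.inr fun v hv hv' => (h v hv hv').trans (Nat.lt_succ_self j))
  · exact Or.inr (Or.inr h.2)

lemma lowerHorn_le_last (n : ℕ) : lowerHorn n n ≤ lowerHornLast n := fun _ => Or.inl

variable {n : ℕ} {j : Fin (n + 1)} {c : Set (Fin (n + 2) × Fin 2)}

lemma faceShuffle_mem : Set.range (faceShuffle j) ∈ lowerHornFace n j := by
  refine Or.inr ⟨?_, ?_⟩
  · rintro _ ⟨a, rfl⟩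
    exact Fin.castSucc_ne_last _
  · rintro _ ⟨a, rfl⟩ h
    exact Nat.lt_succ_of_le (((mem_range_shuffle j _).1 ⟨a, rfl⟩).1 h)

lemma faceShuffle_compl_mem (k : Fin (n + 2)) (hk : k ≠ j.succ) :
    faceShuffle j '' {k}ᶜ ∈ lowerHorn n j := by
  rcases shuffle_compl_mem_lower j k hk with ⟨l, hl⟩ | h
  · left
    refine ⟨l, ?_⟩
    rintro _ ⟨a, ha, rfl⟩ h
    exact hl _ ⟨a, ha, rfl⟩ (Fin.castSucc_injective _ h)
  · right; right
    rintro _ ⟨a, ha, rfl⟩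
    exact h _ ⟨a, ha, rfl⟩

/-- For `j = n` the facet would be the bottom of the prism over the last face, which `lowerHorn`
contains; `hj` keeps a vertex at height 1. -/
lemma faceShuffle_compl_notMem (hj : (j : ℕ) < n) : faceShuffle j '' {j.succ}ᶜ ∉ lowerHorn n j := by
  rintro (⟨k, hk⟩ | h | h)
  · obtain ⟨_, ⟨a, ha, rfl⟩, hvk⟩ := exists_mem_shuffle_compl j k
    exact hk _ ⟨a, ha, rfl⟩ (congrArg Fin.castSucc hvk)
  · have := h _ ⟨Fin.last _, fun h => by
      have := congrArg Fin.val h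
      simp at this
      omega, rfl⟩
    change ((shuffle j (Fin.last _)).2 : ℕ) = 0 at this
    rw [coe_snd_shuffle, if_neg (by simp; omega)] at this
    omega
  · obtain ⟨a, ha, h'⟩ := mem_shuffle_compl j
    have h₁ : faceShuffle j a = (j.castSucc, 0) :=
      Prod.ext (congrArg (fun v => v.1.castSucc) h') (congrArg (fun v => v.2) h')
    have := h _ ⟨a, ha, rfl⟩
    rw [h₁] at this
    exact lt_irrefl _ (this rfl)

/-- A set of vertices which lies over neither the last horn nor the bottom of the prism, and which
has a vertex `(x, 0)` with `x ≥ j`. -/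
lemma exists_of_notMem_lowerHorn {j : ℕ} (h : c ∉ lowerHorn n j) :
    (∀ k : Fin (n + 1), ∃ v ∈ c, v.1 = k.castSucc) ∧ (∃ v ∈ c, (v.2 : ℕ) = 1) ∧
      ∃ v ∈ c, (v.2 : ℕ) = 0 ∧ j ≤ v.1 := by
  rw [mem_lowerHorn, not_or, not_or] at h
  push Not at h
  obtain ⟨h₁, ⟨v, hv, hv'⟩, h₃⟩ := h
  exact ⟨h₁, ⟨v, hv, by omega⟩, h₃⟩

/-- The new sets avoid the last vertex of `Δ[n + 1]`, so they are vertex sets in `Δ[n] × Δ[1]` and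
`subset_range_shuffle` applies there. -/
lemma lowerHornFace_cover (hc : c ∈ lowerHornFace n j) (hc' : IsChain (· ≤ ·) c) :
    c ∈ lowerHorn n j ∨ c ⊆ Set.range (faceShuffle j) := by
  refine or_iff_not_imp_left.2 fun h w hw => ?_
  obtain ⟨h₁, h₂⟩ := hc.resolve_left h
  let c' : Set (Fin (n + 1) × Fin 2) := {v | (v.1.castSucc, v.2) ∈ c}
  have hc'' : IsChain (· ≤ ·) c' := fun v hv w hw hvw =>
    hc' hv hw fun h => hvw (Prod.ext (Fin.castSucc_injective _ (congrArg Prod.fst h))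
      (congrArg Prod.snd h :))
  have hmem : ∀ v ∈ c, ∃ v' ∈ c', (v'.1.castSucc, v'.2) = v := fun v hv =>
    ⟨(v.1.castPred (h₁ v hv), v.2), by simpa [c'] using hv, by simp⟩
  obtain ⟨w, hw, rfl⟩ := hmem w hw
  obtain ⟨v, hv, h₄, h₅⟩ := (exists_of_notMem_lowerHorn h).2.2
  obtain ⟨v, hv, rfl⟩ := hmem v hv
  obtain ⟨a, rfl⟩ := subset_range_shuffle j hc''
    (fun v hv hv' => Nat.lt_succ_iff.1 (h₂ _ hv hv')) ⟨v, hv, h₄, h₅⟩ hw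
  exact ⟨a, rfl⟩

lemma shuffle_mem_lowerHorn (j : Fin (n + 2)) : Set.range (shuffle j) ∈ lowerHorn n (j + 1) :=
  Or.inr (Or.inr fun v hv h => Nat.lt_succ_of_le (((mem_range_shuffle j v).1 hv).1 h))

/-- The facet over the last face of `Δ[n + 1]` is not over the horn; it is available because the
shuffle of that face was attached just before. -/
lemma shuffle_compl_mem_lowerHornFace (j : Fin (n + 2)) (k : Fin (n + 3)) (hk : k ≠ j.succ) :
    shuffle j '' {k}ᶜ ∈ lowerHornFace n j := by
  rcases shuffle_compl_mem_lower j k hk with ⟨l, hl⟩ | h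
  · obtain ⟨l, rfl⟩ | rfl := l.eq_castSucc_or_eq_last
    · exact Or.inl (Or.inl ⟨l, hl⟩)
    · exact Or.inr ⟨hl, fun v hv h => Nat.lt_succ_of_le
        (((mem_range_shuffle j v).1 (Set.image_subset_range _ _ hv)).1 h)⟩
  · exact Or.inl (Or.inr (Or.inr h))

lemma shuffle_compl_notMem_lowerHornFace (j : Fin (n + 2)) (hj : (j : ℕ) < n) :
    shuffle j '' {j.succ}ᶜ ∉ lowerHornFace n j := by
  rintro ((⟨k, hk⟩ | h | h) | ⟨h, -⟩)
  · obtain ⟨v, hv, hvk⟩ := exists_mem_shuffle_compl j k.castSucc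
    exact hk v hv hvk
  · have := h _ ⟨Fin.last _, fun h => by
      have := congrArg Fin.val h
      simp at this
      omega, rfl⟩
    rw [coe_snd_shuffle, if_neg (by simp)] at this
    omega
  · exact lt_irrefl _ (h _ (mem_shuffle_compl j) rfl)
  · obtain ⟨v, hv, hvk⟩ := exists_mem_shuffle_compl j (Fin.last _)
    exact h v hv hvk

lemma lowerHorn_cover (j : Fin (n + 2)) (hc : c ∈ lowerHorn n (j + 1))
    (hc' : IsChain (· ≤ ·) c) : c ∈ lowerHornFace n j ∨ c ⊆ Set.range (shuffle j) := by
  refine or_iff_not_imp_left.2 fun h => ?_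
  obtain ⟨h₁, ⟨v, hv, h₂⟩, h₃⟩ := exists_of_notMem_lowerHorn fun h' => h (Or.inl h')
  refine subset_range_shuffle j hc' (fun w hw hw' => ?_) h₃
  rcases hc with ⟨k, hk⟩ | h' | h'
  · obtain ⟨v, hv, hvk⟩ := h₁ k
    exact absurd hvk (hk v hv)
  · have := h' v hv
    omega
  · exact Nat.lt_succ_iff.1 (h' w hw hw')

lemma shuffle_last_mem_lowerHornLast :
    Set.range (shuffle (Fin.last (n + 1))) ∈ lowerHornLast n :=
  Or.inr fun v hv h => Fin.last_le_iff.1 (((mem_range_shuffle _ v).1 hv).2 h)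

/-- The vertices are `(0, 0), …, (n+1, 0), (n+1, 1)`. Dropping `(k, 0)` with `k ≤ n` leaves a facet
over the horn, and dropping `(n+1, 1)` leaves the bottom; the free facet lacks `(n+1, 0)`. -/
lemma shuffle_last_compl_mem_lowerHorn (k : Fin (n + 3))
    (hk : k ≠ (Fin.last (n + 1)).castSucc) :
    shuffle (Fin.last (n + 1)) '' {k}ᶜ ∈ lowerHorn n n := by
  have hk' : (k : ℕ) ≠ n + 1 := fun h => hk (Fin.ext h)
  by_cases h : (k : ℕ) ≤ n
  · refine Or.inl ⟨⟨k, by omega⟩, ?_⟩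
    rintro _ ⟨a, ha, rfl⟩ h'
    have ha' : (a : ℕ) ≠ k := fun h => ha (Fin.ext h)
    have h'' := congrArg Fin.val h'
    rw [coe_fst_shuffle] at h''
    simp only [Fin.val_last, Fin.val_castSucc] at h''
    split_ifs at h'' <;> omega
  · refine Or.inr (Or.inl ?_)
    rintro _ ⟨a, ha, rfl⟩
    have ha' : (a : ℕ) ≠ k := fun h => ha (Fin.ext h)
    rw [coe_snd_shuffle, if_pos]
    simp only [Fin.val_last]
    omega

lemma shuffle_last_compl_notMem_lowerHorn :
    shuffle (Fin.last (n + 1)) '' {(Fin.last (n + 1)).castSucc}ᶜ ∉ lowerHorn n n := by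
  have hmem : ∀ k : Fin (n + 1), (k.castSucc, 0) ∈
      shuffle (Fin.last (n + 1)) '' {(Fin.last (n + 1)).castSucc}ᶜ := fun k => by
    refine ⟨k.castSucc.castSucc, fun h => ?_, Prod.ext (Fin.ext ?_) (Fin.ext ?_)⟩
    · have := congrArg Fin.val h
      simp at this
      omega
    · rw [coe_fst_shuffle, if_pos (by simp)]; rfl
    · rw [coe_snd_shuffle, if_pos (by simp)]; rfl
  rintro (⟨k, hk⟩ | h | h)
  · exact hk _ (hmem k) rfl
  · have := h _ ⟨Fin.last _, fun h => by simp [Fin.ext_iff] at h, rfl⟩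
    rw [coe_snd_shuffle, if_neg (by simp)] at this
    omega
  · exact lt_irrefl _ (h _ (hmem (Fin.last n)) rfl)

lemma lowerHornLast_cover (hc : c ∈ lowerHornLast n) :
    c ∈ lowerHorn n n ∨ c ⊆ Set.range (shuffle (Fin.last (n + 1))) :=
  hc.imp id fun h w hw => (mem_range_shuffle _ w).2
    ⟨fun _ => Fin.le_last w.1, fun h' => (congrArg Fin.val (h w hw h')).ge⟩

/-- The vertices are `(0, 0), …, (n, 0), (n, 1), (n+1, 1)`. The facet without `(n, 1)` came with the
preceding shuffle; the free facet lacks `(n+1, 1)` and lies over the last face. -/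
lemma shuffle_compl_mem_lowerHornLast (k : Fin (n + 3)) (hk : k ≠ Fin.last (n + 2)) :
    shuffle (Fin.last n).castSucc '' {k}ᶜ ∈ lowerHornLast n := by
  have hk' : (k : ℕ) ≠ n + 2 := fun h => hk (Fin.ext h)
  rcases lt_trichotomy (k : ℕ) n with h | h | h
  · refine Or.inl (Or.inl ⟨⟨k, by omega⟩, ?_⟩)
    rintro _ ⟨a, ha, rfl⟩ h'
    have ha' : (a : ℕ) ≠ k := fun h => ha (Fin.ext h)
    have h'' := congrArg Fin.val h'
    rw [coe_fst_shuffle] at h''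
    simp only [Fin.val_last, Fin.val_castSucc] at h''
    split_ifs at h'' <;> omega
  · refine Or.inl (Or.inr (Or.inr ?_))
    rintro _ ⟨a, ha, rfl⟩ h'
    have ha' : (a : ℕ) ≠ k := fun h => ha (Fin.ext h)
    rw [coe_snd_shuffle] at h'
    rw [coe_fst_shuffle]
    simp only [Fin.val_last, Fin.val_castSucc] at h' ⊢
    split_ifs at *
    omega
  · refine Or.inr ?_
    rintro _ ⟨a, ha, rfl⟩ h'
    have ha' : (a : ℕ) ≠ k := fun h => ha (Fin.ext h)
    rw [coe_snd_shuffle] at h'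
    refine Fin.ext ?_
    rw [coe_fst_shuffle]
    simp only [Fin.val_last, Fin.val_castSucc] at h' ⊢
    split_ifs at *
    omega

lemma shuffle_compl_notMem_lowerHornLast :
    shuffle (Fin.last n).castSucc '' {Fin.last (n + 2)}ᶜ ∉ lowerHornLast n := by
  have hmem : ∀ k : Fin (n + 1), (k.castSucc, 0) ∈
      shuffle (Fin.last n).castSucc '' {Fin.last (n + 2)}ᶜ := fun k => by
    refine ⟨k.castSucc.castSucc, fun h => ?_, Prod.ext (Fin.ext ?_) (Fin.ext ?_)⟩
    · have := congrArg Fin.val h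
      simp at this
      omega
    · rw [coe_fst_shuffle, if_pos (by simp; omega)]; rfl
    · rw [coe_snd_shuffle, if_pos (by simp; omega)]; rfl
  have hmem' : ((Fin.last n).castSucc, 1) ∈
      shuffle (Fin.last n).castSucc '' {Fin.last (n + 2)}ᶜ := by
    refine ⟨(Fin.last (n + 1)).castSucc, fun h => ?_, Prod.ext (Fin.ext ?_) (Fin.ext ?_)⟩
    · simp [Fin.ext_iff] at h
    · rw [coe_fst_shuffle, if_neg (by simp)]; rfl
    · rw [coe_snd_shuffle, if_neg (by simp)]; rfl
  rintro ((⟨k, hk⟩ | h | h) | h)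
  · exact hk _ (hmem k) rfl
  · exact absurd (h _ hmem') (by simp)
  · exact lt_irrefl _ (h _ (hmem (Fin.last n)) rfl)
  · exact Fin.castSucc_ne_last _ (h _ hmem' rfl)

lemma top_cover (hc' : IsChain (· ≤ ·) c) :
    c ∈ lowerHornLast n ∨ c ⊆ Set.range (shuffle (Fin.last n).castSucc) := by
  refine or_iff_not_imp_left.2 fun h => ?_
  rw [mem_lowerHornLast, not_or] at h
  obtain ⟨h₁, h₂⟩ := h
  push Not at h₂
  obtain ⟨w, hw, h₃, h₄⟩ := h₂
  have h₅ : (w.1 : ℕ) < n + 1 := Fin.val_lt_last h₄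
  refine subset_range_shuffle _ hc' (fun v hv h₆ => ?_) (exists_of_notMem_lowerHorn h₁).2.2
  change (v.1 : ℕ) ≤ n
  rcases hc'.total hv hw with h₇ | h₇
  · have : (v.1 : ℕ) ≤ w.1 := h₇.1
    omega
  · have : (w.2 : ℕ) ≤ v.2 := h₇.2
    omega

end Prism

/-! ### Restriction along the filtrations is a cover. -/

section

variable {C : Type u} [Category.{v} C] [HasFiniteLimits C]

lemma IsDescent.of_isIso (cover : MorphismProperty C) [IsDescent cover] {X Y : C} (f : X ⟶ Y)
    [IsIso f] : cover f :=
  IsDescent.of_isPullback (IsPullback.of_vert_isIso (snd := f) (f := 𝟙 Y) (fst := f) (g := 𝟙 Y)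
    ⟨rfl⟩) (IsDescent.id_mem _)

lemma IsDescent.respectsIso (cover : MorphismProperty C) [IsDescent cover] :
    cover.RespectsIso :=
  MorphismProperty.RespectsIso.mk _
    (fun e _ hf => IsDescent.comp_mem _ _ (IsDescent.of_isIso cover e.hom) hf)
    fun e _ hf => IsDescent.comp_mem _ _ hf (IsDescent.of_isIso cover e.hom)

/-- An inclusion of simplicial subsets along which the restriction of maps to `Y` is a cover. -/
def IsCoverExt (cover : MorphismProperty C) (Y : SimplicialObject C) {T : SSet.{0}} [T.Finite]
    (A B : T.Subcomplex) : Prop :=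
  ∃ h : A ≤ B, cover (Map.restr (SSet.Subcomplex.homOfLE h) Y)

namespace IsCoverExt

variable {cover : MorphismProperty C} [IsDescent cover] {Y : SimplicialObject C} {T : SSet.{0}}
  [T.Finite] {A B D : T.Subcomplex}

lemma refl (A : T.Subcomplex) : IsCoverExt cover Y A A :=
  ⟨le_rfl, by
    rw [SSet.Subcomplex.homOfLE_refl, Map.restr_id]
    exact IsDescent.id_mem _⟩

lemma trans (h : IsCoverExt cover Y A B) (h' : IsCoverExt cover Y B D) : IsCoverExt cover Y A D :=
  ⟨h.1.trans h'.1, by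
    rw [← SSet.Subcomplex.homOfLE_comp h.1 h'.1, Map.restr_comp]
    exact IsDescent.comp_mem _ _ h'.2 h.2⟩

/-- Restriction to `flag p` is a base change of the horn map `Y_m ⟶ Map Λ[m, i] Y`. -/
lemma flag {n m : ℕ} {p q : LowerSet (Set (Fin (n + 1) × Fin 2))} {k : ℕ}
    (hY : IsKGroupoid cover k Y) (hm : 0 < m) (hpq : p ≤ q)
    (φ : Fin (m + 1) →o Fin (n + 1) × Fin 2) (hφ : Function.Injective φ) (i : Fin (m + 1))
    (hq : Set.range φ ∈ q) (hp : ∀ k, k ≠ i → φ '' {k}ᶜ ∈ p) (hi : φ '' {i}ᶜ ∉ p)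
    (hcover : ∀ c ∈ q, IsChain (· ≤ ·) c → c ∈ p ∨ c ⊆ Set.range φ) :
    IsCoverExt cover Y (Prism.flag p) (Prism.flag q) :=
  ⟨Prism.flag_mono hpq, IsDescent.of_isPullback
    (Prism.isPullback_flag hpq φ hφ i hq hp hi hcover Y).flip (hY.cover_horn m i hm)⟩

end IsCoverExt

namespace Prism

instance isIso_flag_top (n : ℕ) : IsIso (flag (⊤ : LowerSet (Set (Fin (n + 1) × Fin 2)))).ι := by
  have : flag (⊤ : LowerSet (Set (Fin (n + 1) × Fin 2))) = ⊤ := by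
    refine top_le_iff.1 fun m z _ => mem_flag.2 trivial
  rw [this]
  exact (SSet.Subcomplex.topIso (Δ[n] ⊗ Δ[1] : SSet.{0})).isIso_hom

variable {cover : MorphismProperty C} [IsDescent cover] {Y : SimplicialObject C} {k : ℕ}

lemma isCoverExt_lower (hY : IsKGroupoid cover k Y) (n j : ℕ) (hj : j ≤ n + 1) :
    IsCoverExt cover Y (flag (lower n 0)) (flag (lower n j)) := by
  induction j with
  | zero => exact IsCoverExt.refl _
  | succ j ih =>
    exact (ih (by omega)).trans (IsCoverExt.flag hY (Nat.succ_pos _)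
      (lower_mono n (Nat.le_succ j)) (shuffle (⟨j, by omega⟩ : Fin (n + 1))) (shuffle_injective _)
      _ (shuffle_mem_lower _) (shuffle_compl_mem_lower _) (shuffle_compl_notMem_lower _)
      fun c hc hc' => lower_cover ⟨j, by omega⟩ hc hc')

lemma isCoverExt_lowerHorn (hY : IsKGroupoid cover k Y) (n j : ℕ) (hj : j ≤ n) :
    IsCoverExt cover Y (flag (lowerHorn n 0)) (flag (lowerHorn n j)) := by
  induction j with
  | zero => exact IsCoverExt.refl _
  | succ j ih =>
    refine (ih (by omega)).trans (IsCoverExt.trans (B := flag (lowerHornFace n j)) ?_ ?_)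
    · exact IsCoverExt.flag hY (Nat.succ_pos _) (lowerHorn_le_face n j)
        (faceShuffle (⟨j, by omega⟩ : Fin (n + 1))) (faceShuffle_injective _) _ faceShuffle_mem
        faceShuffle_compl_mem (faceShuffle_compl_notMem hj) fun c hc hc' =>
          lowerHornFace_cover (j := ⟨j, by omega⟩) hc hc'
    · exact IsCoverExt.flag hY (Nat.succ_pos _) (lowerHornFace_le n j)
        (shuffle (⟨j, by omega⟩ : Fin (n + 2))) (shuffle_injective _) _ (shuffle_mem_lowerHorn _)
        (shuffle_compl_mem_lowerHornFace _) (shuffle_compl_notMem_lowerHornFace _ hj)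
        fun c hc hc' => lowerHorn_cover ⟨j, by omega⟩ hc hc'

/-- Over the last face, the `n`th shuffle has its whole boundary in `lowerHorn n n`, since the
bottom is included, so it cannot be attached along a horn. It enters instead as the free facet of
the `n`th shuffle over `Δ[n + 1]`. That shuffle needs a facet of the `(n+1)`st, which therefore
comes first. -/
lemma isCoverExt_lowerHorn_top (hY : IsKGroupoid cover k Y) (n : ℕ) :
    IsCoverExt cover Y (flag (lowerHorn n 0)) (flag ⊤) :=
  (isCoverExt_lowerHorn hY n n le_rfl).trans <|
    (IsCoverExt.flag hY (Nat.succ_pos _) (lowerHorn_le_last n) (shuffle (Fin.last (n + 1)))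
      (shuffle_injective _) _ shuffle_last_mem_lowerHornLast shuffle_last_compl_mem_lowerHorn
      shuffle_last_compl_notMem_lowerHorn fun _ hc _ => lowerHornLast_cover hc).trans <|
    IsCoverExt.flag hY (Nat.succ_pos _) le_top (shuffle (Fin.last n).castSucc)
      (shuffle_injective _) _ trivial shuffle_compl_mem_lowerHornLast
      shuffle_compl_notMem_lowerHornLast fun _ _ hc' => top_cover hc'

lemma mem_lower_last (n : ℕ) (c : Set (Fin (n + 1) × Fin 2)) : c ∈ lower n (n + 1) :=
  Or.inr fun v _ _ => v.1.isLt

lemma lower_last (n : ℕ) : lower n (n + 1) = ⊤ :=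
  top_le_iff.1 fun c _ => mem_lower_last n c

lemma cover_restr_ι {n : ℕ} {p : LowerSet (Set (Fin (n + 1) × Fin 2))}
    (h : IsCoverExt cover Y (flag p) (flag ⊤)) : cover (Map.restr (flag p).ι Y) := by
  have h₁ : Map.restr (flag p).ι Y =
      Map.restr (flag ⊤).ι Y ≫ Map.restr (SSet.Subcomplex.homOfLE h.1) Y := by
    rw [← Map.restr_comp, SSet.Subcomplex.homOfLE_ι]
  have := Map.isIso_restr (flag (⊤ : LowerSet (Set (Fin (n + 1) × Fin 2)))).ι Y
  rw [h₁]
  exact IsDescent.comp_mem _ _ (IsDescent.of_isIso cover _) h.2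

lemma cover_restr_lower (hY : IsKGroupoid cover k Y) (n : ℕ) :
    cover (Map.restr (flag (lower n 0)).ι Y) :=
  cover_restr_ι (lower_last n ▸ isCoverExt_lower hY n (n + 1) le_rfl)

lemma cover_restr_lowerHorn (hY : IsKGroupoid cover k Y) (n : ℕ) :
    cover (Map.restr (flag (lowerHorn n 0)).ι Y) :=
  cover_restr_ι (isCoverExt_lowerHorn_top hY n)

/-- The prism is obtained from `lower n n` by attaching the last shuffle along the last horn. -/
lemma isPullback_lower_last (n : ℕ) (Y : SimplicialObject C) :
    IsPullback (Map.restr (flag (lower n n)).ι Y)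
      (Map.evHom (simplex (shuffle (Fin.last n))) Y)
      (Map.restr (hornToFlag (lower n n) (shuffle (Fin.last n)) (Fin.last (n + 1))
        (shuffle_compl_mem_lower (Fin.last n))) Y)
      (Map.ofSimplex (SSet.horn (n + 1) (Fin.last (n + 1))) Y) := by
  have h := isPullback_flag le_top (shuffle (Fin.last n)) (shuffle_injective _) (Fin.last (n + 1))
    trivial (shuffle_compl_mem_lower (Fin.last n)) (shuffle_compl_notMem_lower (Fin.last n))
    (fun c _ hc => lower_cover _ (mem_lower_last n c) hc) Y
  have := Map.isIso_restr (flag (⊤ : LowerSet (Set (Fin (n + 1) × Fin 2)))).ι Y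
  refine IsPullback.of_iso h (asIso (Map.restr (flag ⊤).ι Y)).symm (Iso.refl _) (Iso.refl _)
    (Iso.refl _) ?_ ?_ ?_ ?_
  · rw [Iso.refl_hom, Category.comp_id, Iso.symm_hom, asIso_inv, IsIso.eq_inv_comp,
      ← Map.restr_comp]
    rfl
  · rw [Iso.refl_hom, Category.comp_id, Iso.symm_hom, asIso_inv, IsIso.eq_inv_comp,
      Map.restr_evHom]
    rfl
  · simp
  · simp

end Prism

end

/-! ### The matching maps of `q(f)` in terms of prisms. -/

namespace Prism

/-- The vertices of the bottom `(ε = 0)` or top `(ε = 1)` of the prism. -/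
def level (n : ℕ) (ε : Fin 2) : Fin (n + 1) →o Fin (n + 1) × Fin 2 where
  toFun k := (k, ε)
  monotone' _ _ h := ⟨h, le_rfl⟩

lemma level_injective (n : ℕ) (ε : Fin 2) : Function.Injective (level n ε) :=
  fun _ _ h => congrArg Prod.fst h

lemma level_compl_mem_lower (n j : ℕ) (ε : Fin 2) (k : Fin (n + 1)) :
    level n ε '' {k}ᶜ ∈ lower n j := by
  refine Or.inl ⟨k, ?_⟩
  rintro _ ⟨a, ha, rfl⟩
  exact ha

lemma level_one_mem_lower (n j : ℕ) : Set.range (level n 1) ∈ lower n j := by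
  refine Or.inr ?_
  rintro _ ⟨a, rfl⟩ h
  exact absurd h one_ne_zero

/-- The bottom of the prism over the boundary. -/
abbrev bottom (n j : ℕ) : (SSet.boundary n : SSet.{0}) ⟶ (flag (lower n j) : SSet.{0}) :=
  boundaryToFlag (lower n j) (level n 0) (level_compl_mem_lower n j 0)

/-- The prism over the boundary. -/
def side (n : ℕ) : (SSet.boundary n : SSet.{0}) ⊗ Δ[1] ⟶ (flag (lower n 0) : SSet.{0}) :=
  SSet.Subcomplex.lift ((SSet.boundary n).ι ▷ Δ[1]) (by
    rintro l _ ⟨⟨⟨s, hs⟩, y⟩, rfl⟩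
    obtain ⟨k, hk⟩ := not_forall.1 hs
    refine mem_flag.2 (Or.inl ⟨k, ?_⟩)
    rintro _ ⟨a, rfl⟩
    exact fun h => hk ⟨a, h⟩)

/-- The inclusion of an end of the cylinder `S × Δ[1]`. -/
def cylinderEnd (S : SSet.{0}) (ε : Fin 2) : S ⟶ S ⊗ Δ[1] where
  app m := ↾fun x => (x, SSet.stdSimplex.const 1 ε m)

lemma cylinderEnd_zero_side (n : ℕ) : cylinderEnd _ 0 ≫ side n = bottom n 0 := by
  ext m x
  exact Subtype.ext (verts_injective rfl)

end Prism

section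

variable {C : Type u} [Category.{v} C] [HasFiniteLimits C]

open Prism

/-- The value of `P_1 Y` in degree `n` is the space of maps from the prism to `Y`. -/
noncomputable def P.prismIso (Y : SimplicialObject C) (n : ℕ) :
    (P 1 Y) _⦋n⦌ ≅ Map (Δ[n] ⊗ Δ[1]) Y :=
  Iso.refl _

lemma P.evVertex_app (n : ℕ) (ε : Fin 2) (Y : SimplicialObject C) :
    (P.evVertex 1 ε Y).app (op ⦋n⦌) =
      (P.prismIso Y n).hom ≫ Map.evHom (simplex (level n ε)) Y :=
  (Category.id_comp _).symm

/-- `flag (lower n 0)` is the cylinder on the boundary with the top simplex glued to its end at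
height 1. -/
lemma isPullback_sides (n : ℕ) (Y : SimplicialObject C) :
    IsPullback (Map.restr (side n) Y ≫ (Map.curry _ 1 Y).hom)
      (Map.evHom (simplexToFlag (lower n 0) (level n 1) (level_one_mem_lower n 0)) Y)
      (Map.post (SSet.boundary n) (P.evVertex 1 1 Y)) (Map.ofSimplex (SSet.boundary n) Y) := by
  have h := Map.isPullback_attach (SSet.boundary n) (side n)
    (simplexToFlag (lower n 0) (level n 1) (level_one_mem_lower n 0)) (cylinderEnd _ 1)
    (by
      ext m x
      exact Subtype.ext (verts_injective rfl))
    (fun l x y hxy => ?_) (fun l x y hxy => ?_) (fun l z => ?_) (fun l x y hxy => ?_) Y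
  · refine IsPullback.of_iso h (Iso.refl _) (Map.curry _ 1 Y) (Iso.refl _) (Iso.refl _) ?_ ?_ ?_ ?_
    · simp
    · simp
    · rw [Iso.refl_hom, Category.comp_id]
      exact (Map.curry_hom_post_evVertex _ 1 1 Y (cylinderEnd _ 1) fun _ _ => rfl).symm
    · simp
  · have h := congrArg Subtype.val hxy
    exact Prod.ext (Subtype.ext (congrArg Prod.fst h :)) (congrArg Prod.snd h :)
  · exact simplex_injective _ (level_injective n 1) l (congrArg Subtype.val hxy)
  · obtain ⟨z, hz⟩ := z
    rcases mem_flag.1 hz with ⟨k, hk⟩ | h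
    · exact Or.inl ⟨(⟨z.1, fun h => by
        obtain ⟨a, ha⟩ := h k
        exact hk _ ⟨a, rfl⟩ ha⟩, z.2), rfl⟩
    · refine Or.inr ?_
      obtain ⟨s, hs⟩ := exists_simplex (level n 1) (level_injective n 1) z (by
        rintro _ ⟨a, rfl⟩
        have := h _ ⟨a, rfl⟩
        exact ⟨(verts z a).1, Prod.ext rfl (Fin.ext (by
          change 1 = ((verts z a).2 : ℕ)
          omega))⟩)
      exact ⟨s, Subtype.ext hs⟩
  · have h : x.1.1 = y := (congrArg (fun z => z.1.1) hxy :).trans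
      (SSet.stdSimplex.objEquiv.injective (by ext a; rfl))
    rw [← h]
    exact x.1.2

/-- The morphism `X_n ×_{Y_n} Map (Δ[n] × Δ[1]) Y ⟶ Map ∂Δ[n] X ×_{Map ∂Δ[n] Y} Map A Y`, where `A`
is the union of the top and the sides of the prism. -/
noncomputable def pathMap {X Y : SimplicialObject C} (f : X ⟶ Y) (n : ℕ) :
    pullback (f.app (op ⦋n⦌)) (Map.evHom (simplex (level n 0)) Y) ⟶
      pullback (Map.post (SSet.boundary n) f) (Map.restr (bottom n 0) Y) :=
  pullback.map _ _ _ _ (Map.ofSimplex (SSet.boundary n) X) (Map.restr (flag (lower n 0)).ι Y)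
    (Map.ofSimplex (SSet.boundary n) Y) (Map.ofSimplex_post _ f).symm (by
      rw [Map.ofSimplex_eq, Map.evHom_ofHom, ← Map.restr_comp]
      rfl)

lemma Map.ofSimplex_P {n : ℕ} (A : (Δ[n] : SSet.{0}).Subcomplex) (Y : SimplicialObject C) :
    Map.ofSimplex A (P 1 Y) = (P.prismIso Y n).hom ≫
      Map.restr (A.ι ▷ Δ[1]) Y ≫ (Map.curry (A : SSet.{0}) 1 Y).hom :=
  Map.hom_ext fun m x => by
    have h : (Map.curry (A : SSet.{0}) 1 Y).hom ≫ Map.ev (P 1 Y) x = Map.curryEv 1 Y x :=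
      Map.lift_ev _ (fun m m' g x => Map.curryEv_map 1 Y x g) x
    rw [Map.ofSimplex_ev, Category.assoc, Category.assoc, h]
    refine Eq.trans ?_ (congrArg _ (Map.restr_comp _ _ _))
    exact (Category.id_comp _).symm

/-- The target of the matching map of the morphism that sends a path to its end point. -/
lemma exists_isPullback_matching {W X Y : SimplicialObject C} {f : X ⟶ Y} {a : W ⟶ X}
    {b : W ⟶ P 1 Y} (h : IsPullback a b f (P.evVertex 1 0 Y)) (n : ℕ) :
    ∃ (l : pullback (Map.post (SSet.boundary n) (b ≫ P.evVertex 1 1 Y))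
        (Map.ofSimplex (SSet.boundary n) Y) ⟶ Map (flag (lower n 0)) Y),
      IsPullback (pullback.fst _ _ ≫ Map.post _ a) l (Map.post (SSet.boundary n) f)
        (Map.restr (bottom n 0) Y) ∧
      matchingMap (b ≫ P.evVertex 1 1 Y) n ≫ l =
        b.app (op ⦋n⦌) ≫ (P.prismIso Y n).hom ≫ Map.restr (flag (lower n 0)).ι Y := by
  have hG := isPullback_sides n Y
  have hw := IsPullback.of_hasPullback (Map.post (SSet.boundary n) (b ≫ P.evVertex 1 1 Y))
    (Map.ofSimplex (SSet.boundary n) Y)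
  have hq := Map.post_comp (SSet.boundary n : SSet.{0}) b (P.evVertex 1 1 Y)
  have hP := Map.isPullback_post (SSet.boundary n : SSet.{0}) h
  have hw' := hw.w
  have hbot : (Map.restr (side n) Y ≫ (Map.curry _ 1 Y).hom) ≫
      Map.post (SSet.boundary n) (P.evVertex 1 0 Y) = Map.restr (bottom n 0) Y := by
    rw [Category.assoc, Map.curry_hom_post_evVertex _ 1 0 Y (cylinderEnd _ 0) (fun _ _ => rfl),
      ← Map.restr_comp, cylinderEnd_zero_side]
  -- The paths over the boundary give the sides of the prism, and the simplex of `Y_n` gives its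
  -- top.
  let l := hG.lift (pullback.fst (Map.post (SSet.boundary n) (b ≫ P.evVertex 1 1 Y))
    (Map.ofSimplex (SSet.boundary n) Y) ≫ Map.post _ b)
    (pullback.snd _ _) (by rw [Category.assoc, ← hq, hw'])
  have hl₁ : l ≫ _ = _ := hG.lift_fst _ _ _
  have hl₂ : l ≫ _ = _ := hG.lift_snd _ _ _
  refine ⟨l, ?_, ?_⟩
  · have h₁ : IsPullback l (pullback.fst _ _) _ _ := IsPullback.of_right (h₁₁ := l)
      (v₁₁ := pullback.fst _ _) (by rw [hl₂, ← hq]; exact hw.flip) hl₁ hG.flip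
    have h₂ := h₁.paste_vert hP.flip
    rw [hbot] at h₂
    exact h₂.flip
  · refine hG.hom_ext ?_ ?_
    · rw [Category.assoc, hl₁, matchingMap, ← Category.assoc, pullback.lift_fst,
        Map.ofSimplex_post, Map.ofSimplex_P, Category.assoc, Category.assoc,
        ← Category.assoc (Map.restr (flag _).ι Y), ← Map.restr_comp]
      rfl
    · rw [Category.assoc, hl₂, matchingMap, pullback.lift_snd, Category.assoc, Category.assoc,
        Map.restr_evHom, NatTrans.comp_app, P.evVertex_app]
      rfl

lemma cover_matchingMap_iff (cover : MorphismProperty C) [IsDescent cover]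
    {W X Y : SimplicialObject C} {f : X ⟶ Y} {a : W ⟶ X} {b : W ⟶ P 1 Y}
    (h : IsPullback a b f (P.evVertex 1 0 Y)) (n : ℕ) :
    cover (matchingMap (b ≫ P.evVertex 1 1 Y) n) ↔ cover (pathMap f n) := by
  obtain ⟨l, hl, hl'⟩ := exists_isPullback_matching h n
  have hn : IsPullback (a.app (op ⦋n⦌)) (b.app (op ⦋n⦌)) (f.app (op ⦋n⦌))
      ((P.evVertex 1 0 Y).app (op ⦋n⦌)) := h.map ((evaluation _ _).obj (op ⦋n⦌))
  have hn' : IsPullback (a.app (op ⦋n⦌)) (b.app (op ⦋n⦌) ≫ (P.prismIso Y n).hom)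
      (f.app (op ⦋n⦌)) (Map.evHom (simplex (level n 0)) Y) :=
    IsPullback.of_iso hn (Iso.refl _) (Iso.refl _) (P.prismIso Y n) (Iso.refl _) (by simp)
      (by simp) (by simp) (by rw [P.evVertex_app]; simp)
  have := IsDescent.respectsIso cover
  refine cover.arrow_mk_iso_iff (Arrow.isoMk hn'.isoPullback hl.isoPullback ?_)
  refine pullback.hom_ext ?_ ?_ <;> dsimp only [Arrow.mk_hom]
  · rw [Category.assoc, Category.assoc, pathMap, pullback.lift_fst, hl.isoPullback_hom_fst,
      ← Category.assoc, hn'.isoPullback_hom_fst, ← Category.assoc, matchingMap, pullback.lift_fst,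
      Map.ofSimplex_post]
  · rw [Category.assoc, Category.assoc, pathMap, pullback.lift_snd, hl.isoPullback_hom_snd,
      ← Category.assoc, hn'.isoPullback_hom_snd, hl', Category.assoc]

lemma isWeakEquivalence_iff_pathMap (cover : MorphismProperty C) [IsDescent cover]
    {X Y : SimplicialObject C} (f : X ⟶ Y) :
    IsWeakEquivalence cover f ↔ ∀ n : ℕ, cover (pathMap f n) :=
  forall_congr' fun n =>
    cover_matchingMap_iff cover (IsPullback.of_hasPullback f (P.evVertex 1 0 Y)) n

end

/-! ### From relative horns to paths: splitting off the last shuffle. -/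

open Prism

namespace Prism

/-- Omitting `(n, 1)` from the last shuffle leaves the bottom. This is why the last face map and the
last horn occur in the theorem. -/
lemma δ_simplex_shuffle (n : ℕ) : SSet.stdSimplex.map (SimplexCategory.δ (Fin.last (n + 1))) ≫
    simplex (shuffle (Fin.last n)) = simplex (level n 0) := by
  refine NatTrans.ext (funext fun m => ConcreteCategory.hom_ext _ _ fun x => ?_)
  refine verts_injective (OrderHom.ext _ _ (funext fun a => ?_))
  let b : Fin (n + 1) := SSet.stdSimplex.asOrderHom x a
  change shuffle (Fin.last n) ((Fin.last (n + 1)).succAbove b) = (b, 0)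
  refine Prod.ext (Fin.ext ?_) (Fin.ext ?_)
  · rw [coe_fst_shuffle, Fin.succAbove_last, if_pos (by simp; omega)]
    rfl
  · rw [coe_snd_shuffle, Fin.succAbove_last, if_pos (by simp; omega)]
    rfl

lemma boundaryToHorn_hornToFlag (n : ℕ) :
    boundaryToHorn n ≫ hornToFlag (lower n n) (shuffle (Fin.last n)) (Fin.last (n + 1))
      (shuffle_compl_mem_lower (Fin.last n)) = bottom n n := by
  ext m x
  refine Subtype.ext ?_
  exact congrArg (fun h => h.app m x.1) (δ_simplex_shuffle n)

end Prism

section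

variable {C : Type u} [Category.{v} C] [HasFiniteLimits C]

lemma Map.evHom_δ {T : SSet.{0}} [T.Finite] {n : ℕ} (g : Δ[n + 1] ⟶ T) (i : Fin (n + 2))
    (X : SimplicialObject C) :
    evHom g X ≫ X.δ i = evHom (SSet.stdSimplex.map (SimplexCategory.δ i) ≫ g) X :=
  evHom_map g _ X

section

variable {X Y : SimplicialObject C} (f : X ⟶ Y) (n : ℕ)

/-- The first factor of `pathMap f n`, which forgets the last shuffle of the prism and its bottom. -/
noncomputable def pathMapFst :
    pullback (f.app (op ⦋n⦌)) (Map.evHom (simplex (level n 0)) Y) ⟶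
      pullback (Map.post (SSet.boundary n) f) (Map.restr (bottom n n) Y) :=
  pullback.map _ _ _ _ (Map.ofSimplex (SSet.boundary n) X) (Map.restr (flag (lower n n)).ι Y)
    (Map.ofSimplex (SSet.boundary n) Y) (Map.ofSimplex_post _ f).symm (by
      rw [Map.ofSimplex_eq, Map.evHom_ofHom, ← Map.restr_comp]
      rfl)

lemma restr_lower_bottom (Y : SimplicialObject C) (n : ℕ) :
    Map.restr (SSet.Subcomplex.homOfLE (flag_mono (lower_mono n (Nat.zero_le n)))) Y ≫
      Map.restr (bottom n 0) Y = Map.restr (bottom n n) Y := by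
  rw [← Map.restr_comp]
  rfl

/-- The second factor of `pathMap f n`. -/
noncomputable def pathMapSnd :
    pullback (Map.post (SSet.boundary n) f) (Map.restr (bottom n n) Y) ⟶
      pullback (Map.post (SSet.boundary n) f) (Map.restr (bottom n 0) Y) :=
  pullback.lift (pullback.fst _ _) (pullback.snd _ _ ≫
    Map.restr (SSet.Subcomplex.homOfLE (flag_mono (lower_mono n (Nat.zero_le n)))) Y) (by
      rw [Category.assoc, restr_lower_bottom, pullback.condition])

lemma pathMapFst_pathMapSnd : pathMapFst f n ≫ pathMapSnd f n = pathMap f n := by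
  refine pullback.hom_ext ?_ ?_
  · rw [Category.assoc, pathMapSnd, pullback.lift_fst, pathMapFst, pathMap, pullback.lift_fst,
      pullback.lift_fst]
  · rw [Category.assoc, pathMapSnd, pullback.lift_snd, pathMapFst, pathMap, pullback.lift_snd,
      pullback.lift_snd_assoc, Category.assoc, ← Map.restr_comp]
    rfl

lemma cover_pathMapSnd {cover : MorphismProperty C} [IsDescent cover] {k : ℕ}
    (hY : IsKGroupoid cover k Y) : cover (pathMapSnd f n) := by
  have h : IsPullback (pullback.snd (Map.post (SSet.boundary n) f) (Map.restr (bottom n n) Y))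
      (pathMapSnd f n)
      (Map.restr (SSet.Subcomplex.homOfLE (flag_mono (lower_mono n (Nat.zero_le n)))) Y)
      (pullback.snd _ _) := by
    refine IsPullback.of_bot (h₃₁ := Map.post (SSet.boundary n) f) (v₂₁ := pullback.fst _ _)
      (v₂₂ := Map.restr (bottom n 0) Y) ?_ ?_ (IsPullback.of_hasPullback _ _).flip
    · rw [restr_lower_bottom, pathMapSnd, pullback.lift_fst]
      exact (IsPullback.of_hasPullback _ _).flip
    · rw [pathMapSnd, pullback.lift_snd]
  exact IsDescent.of_isPullback h (isCoverExt_lower hY n n (Nat.le_succ n)).2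

/-- The first factor of `pathMap f n` is a pullback of the relative horn map. -/
lemma isPullback_pathMapFst : ∃ t s, IsPullback t (pathMapFst f n) (relativeHornMap f n) s := by
  have hT := isPullback_lower_last n Y
  let t : pullback (f.app (op ⦋n⦌)) (Map.evHom (simplex (level n 0)) Y) ⟶
      pullback (f.app (op ⦋n⦌)) (Y.δ (Fin.last (n + 1))) :=
    pullback.lift (pullback.fst _ _)
      (pullback.snd _ _ ≫ Map.evHom (simplex (shuffle (Fin.last n))) Y) (by
        rw [Category.assoc, Map.evHom_δ, δ_simplex_shuffle, pullback.condition])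
  have ht₁ : t ≫ pullback.fst _ _ = pullback.fst _ _ := pullback.lift_fst _ _ _
  have ht₂ : t ≫ pullback.snd _ _ = _ := pullback.lift_snd _ _ _
  let s : pullback (Map.post (SSet.boundary n) f) (Map.restr (bottom n n) Y) ⟶
      pullback (Map.post (SSet.boundary n) f) (Map.restr (boundaryToHorn n) Y) :=
    pullback.lift (pullback.fst _ _) (pullback.snd _ _ ≫
      Map.restr (hornToFlag (lower n n) (shuffle (Fin.last n)) (Fin.last (n + 1))
        (shuffle_compl_mem_lower (Fin.last n))) Y) (by
      rw [Category.assoc, ← Map.restr_comp, boundaryToHorn_hornToFlag, pullback.condition])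
  have hs₁ : s ≫ pullback.fst _ _ = pullback.fst _ _ := pullback.lift_fst _ _ _
  have hs₂ : s ≫ pullback.snd _ _ = _ := pullback.lift_snd _ _ _
  have hR₁ : relativeHornMap f n ≫ pullback.fst _ _ = _ := pullback.lift_fst _ _ _
  have hR₂ : relativeHornMap f n ≫ pullback.snd _ _ = _ := pullback.lift_snd _ _ _
  have hw₁ : pathMapFst f n ≫ pullback.fst _ _ = _ := pullback.lift_fst _ _ _
  have hw₂ : pathMapFst f n ≫ pullback.snd _ _ = _ := pullback.lift_snd _ _ _
  refine ⟨t, s, isPullback_of_elements ?_ ?_ ?_⟩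
  · refine pullback.hom_ext ?_ ?_
    · rw [Category.assoc, Category.assoc, hR₁, hs₁, hw₁, ← Category.assoc, ht₁]
    · rw [Category.assoc, Category.assoc, hR₂, hs₂, ← Category.assoc, ht₂, ← Category.assoc, hw₂,
        Category.assoc, Category.assoc, hT.w]
  · intro A a b hab
    have h₁ : (a ≫ relativeHornMap f n) ≫ pullback.fst _ _ = (b ≫ s) ≫ pullback.fst _ _ := by rw [hab]
    have h₂ : (a ≫ relativeHornMap f n) ≫ pullback.snd _ _ = (b ≫ s) ≫ pullback.snd _ _ := by rw [hab]
    rw [Category.assoc, Category.assoc, hR₁, hs₁] at h₁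
    rw [Category.assoc, Category.assoc, hR₂, hs₂] at h₂
    -- The prism is glued from its part in `lower n n`, given by `b`, and the last shuffle, given by
    -- `a`.
    let H := hT.lift (b ≫ pullback.snd _ _) (a ≫ pullback.snd _ _) (by
      rw [Category.assoc, Category.assoc]; exact h₂.symm)
    have hH₁ : H ≫ _ = _ := hT.lift_fst _ _ _
    have hH₂ : H ≫ _ = _ := hT.lift_snd _ _ _
    let l : A ⟶ pullback (f.app (op ⦋n⦌)) (Map.evHom (simplex (level n 0)) Y) :=
      pullback.lift (a ≫ pullback.fst _ _) H (by
        rw [Category.assoc, pullback.condition, ← δ_simplex_shuffle, ← Map.evHom_δ,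
          ← Category.assoc, ← Category.assoc, hH₂])
    have hl₁ : l ≫ pullback.fst _ _ = _ := pullback.lift_fst _ _ _
    have hl₂ : l ≫ pullback.snd _ _ = _ := pullback.lift_snd _ _ _
    refine ⟨l, pullback.hom_ext ?_ ?_, pullback.hom_ext ?_ ?_⟩
    · rw [Category.assoc, ht₁, hl₁]
    · rw [Category.assoc, ht₂, ← Category.assoc, hl₂, hH₂]
    · rw [Category.assoc, hw₁, ← Category.assoc, hl₁, Category.assoc, h₁]
    · rw [Category.assoc, hw₂, ← Category.assoc, hl₂, hH₁]
  · intro A l l' h₁ h₂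
    refine pullback.hom_ext ?_ (hT.hom_ext ?_ ?_)
    · rw [← ht₁, ← Category.assoc, h₁, Category.assoc]
    · rw [Category.assoc, Category.assoc, ← hw₂, ← Category.assoc, h₂, Category.assoc]
    · rw [Category.assoc, Category.assoc, ← ht₂, ← Category.assoc, h₁, Category.assoc]

lemma cover_pathMap_of_cover_relativeHornMap {cover : MorphismProperty C} [IsDescent cover] {k : ℕ}
    (hY : IsKGroupoid cover k Y) (h : cover (relativeHornMap f n)) : cover (pathMap f n) := by
  obtain ⟨t, s, hts⟩ := isPullback_pathMapFst f n
  rw [← pathMapFst_pathMapSnd]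
  exact IsDescent.comp_mem _ _ (IsDescent.of_isPullback hts h) (cover_pathMapSnd f n hY)

end

end

/-! ### From paths to relative horns: collapsing the top of the prism. -/

namespace Prism

/-- The simplices of the prism over `Δ[n + 1]` that lie over the last horn or in the top. -/
def overHorn (n : ℕ) : LowerSet (Set (Fin (n + 2) × Fin 2)) where
  carrier := {c | (∃ k : Fin (n + 1), ∀ v ∈ c, v.1 ≠ k.castSucc) ∨ ∀ v ∈ c, (v.2 : ℕ) ≠ 0}
  lower' _ _ hcd := Or.imp (fun ⟨k, hk⟩ => ⟨k, fun v hv => hk v (hcd hv)⟩)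
    fun h v hv => h v (hcd hv)

lemma overHorn_le_lower (n : ℕ) : overHorn n ≤ lower (n + 1) 0 :=
  fun _ => Or.imp (fun ⟨k, hk⟩ => ⟨k.castSucc, hk⟩) fun h v hv hv' => absurd hv' (h v hv)

lemma overHorn_le_lowerHorn (n : ℕ) : overHorn n ≤ lowerHorn n 0 :=
  fun _ => Or.imp id fun h => Or.inr fun v hv hv' => absurd hv' (h v hv)

lemma mem_lowerHorn_zero {n : ℕ} {c : Set (Fin (n + 2) × Fin 2)} (hc : c ∈ lowerHorn n 0) :
    c ∈ overHorn n ∨ ∀ v ∈ c, (v.2 : ℕ) = 0 := by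
  rcases hc with h | h | h
  · exact Or.inl (Or.inl h)
  · exact Or.inr h
  · exact Or.inl (Or.inr fun v hv hv' => Nat.not_lt_zero _ (h v hv hv'))

/-- The projection of the prism that collapses its top to the last vertex. -/
def collapseVertex (n : ℕ) : Fin (n + 1) × Fin 2 →o Fin (n + 1) where
  toFun v := if (v.2 : ℕ) = 0 then v.1 else Fin.last n
  monotone' v w h := by
    have : (v.2 : ℕ) ≤ w.2 := h.2
    dsimp only
    split_ifs
    · exact h.1
    · exact Fin.le_last _
    · omega
    · exact le_rfl

/-- The map from the prism to the simplex that collapses the top to the last vertex. -/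
def collapse (n : ℕ) : Δ[n] ⊗ Δ[1] ⟶ (Δ[n] : SSet.{0}) where
  app m := ↾fun z => SSet.stdSimplex.objMk ((collapseVertex n).comp (verts z))

lemma level_collapse (n : ℕ) : simplex (level n 0) ≫ collapse n = 𝟙 _ := by
  refine NatTrans.ext (funext fun m => ConcreteCategory.hom_ext _ _ fun x => ?_)
  exact SSet.stdSimplex.objEquiv.injective (by ext a; rfl)

/-- The inclusion of the prism over the last face. -/
def face (n : ℕ) : (Δ[n] ⊗ Δ[1] : SSet.{0}) ⟶ Δ[n + 1] ⊗ Δ[1] :=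
  SSet.stdSimplex.δ (Fin.last (n + 1)) ▷ Δ[1]

lemma verts_face (n : ℕ) {m : SimplexCategoryᵒᵖ} (z : (Δ[n] ⊗ Δ[1] : SSet.{0}).obj m)
    (a : Fin (m.unop.len + 1)) :
    verts ((face n).app m z) a = ((verts z a).1.castSucc, (verts z a).2) :=
  Prod.ext (Fin.succAbove_last_apply _) rfl

lemma level_face (n : ℕ) : simplex (level n 0) ≫ face n =
    SSet.stdSimplex.map (SimplexCategory.δ (Fin.last (n + 1))) ≫ simplex (level (n + 1) 0) := by
  refine NatTrans.ext (funext fun m => ConcreteCategory.hom_ext _ _ fun x => ?_)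
  exact verts_injective rfl

/-- The collapse of the simplices over the horn or in the top. -/
def collapseHorn (n : ℕ) :
    (flag (overHorn n) : SSet.{0}) ⟶ (SSet.horn (n + 1) (Fin.last (n + 1)) : SSet.{0}) :=
  SSet.Subcomplex.lift ((flag (overHorn n)).ι ≫ collapse (n + 1)) (by
    rintro m _ ⟨⟨z, hz⟩, rfl⟩ h
    have h' : ∀ k : Fin (n + 1), ∃ a, collapseVertex (n + 1) (verts z a) = k.castSucc := fun k =>
      (Set.eq_univ_iff_forall.1 h k.castSucc).resolve_right (Fin.castSucc_ne_last k)
    -- The collapse hits a vertex other than the last one only from height 0.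
    have h'' : ∀ k : Fin (n + 1), ∃ a, (verts z a).1 = k.castSucc ∧ ((verts z a).2 : ℕ) = 0 := by
      intro k
      obtain ⟨a, ha⟩ := h' k
      refine ⟨a, ?_⟩
      change (if ((verts z a).2 : ℕ) = 0 then (verts z a).1 else Fin.last (n + 1)) = _ at ha
      split_ifs at ha with h₀
      · exact ⟨ha, h₀⟩
      · exact absurd ha.symm (Fin.castSucc_ne_last k)
    rcases mem_flag.1 hz with ⟨k, hk⟩ | hz
    · obtain ⟨a, ha, -⟩ := h'' k
      exact hk _ ⟨a, rfl⟩ ha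
    · obtain ⟨a, -, ha⟩ := h'' 0
      exact hz _ ⟨a, rfl⟩ ha)

/-- The restriction of `face` to the top and the sides of the prism. -/
def faceOverHorn (n : ℕ) : (flag (lower n 0) : SSet.{0}) ⟶ (flag (overHorn n) : SSet.{0}) :=
  SSet.Subcomplex.lift ((flag (lower n 0)).ι ≫ face n) (by
    rintro m _ ⟨⟨z, hz⟩, rfl⟩
    refine mem_flag.2 ?_
    rcases mem_flag.1 hz with ⟨k, hk⟩ | h
    · refine Or.inl ⟨k, ?_⟩
      rintro _ ⟨a, rfl⟩ ha
      exact hk _ ⟨a, rfl⟩ (Fin.castSucc_injective _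
        ((congrArg Prod.fst (verts_face n z a)).symm.trans ha))
    · refine Or.inr ?_
      rintro _ ⟨a, rfl⟩ ha
      exact Nat.not_lt_zero _ (h _ ⟨a, rfl⟩ ha))

/-- The inclusion of the prism over the last face into the top and the sides of the prism. -/
def faceLower (n : ℕ) : (Δ[n] ⊗ Δ[1] : SSet.{0}) ⟶ (flag (lower (n + 1) 0) : SSet.{0}) :=
  SSet.Subcomplex.lift (face n) (by
    rintro m _ ⟨z, rfl⟩
    refine mem_flag.2 (Or.inl ⟨Fin.last _, ?_⟩)
    rintro _ ⟨a, rfl⟩ ha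
    exact Fin.castSucc_ne_last _ ((congrArg Prod.fst (verts_face n z a)).symm.trans ha))

/-- The bottom of the prism over the horn. -/
def hornOverHorn (n : ℕ) :
    (SSet.horn (n + 1) (Fin.last (n + 1)) : SSet.{0}) ⟶ (flag (overHorn n) : SSet.{0}) :=
  SSet.Subcomplex.lift ((SSet.horn (n + 1) (Fin.last (n + 1))).ι ≫ simplex (level (n + 1) 0)) (by
    rintro m _ ⟨⟨s, hs⟩, rfl⟩
    obtain ⟨k, hk⟩ := (Set.ne_univ_iff_exists_notMem _).1 hs
    rw [Set.mem_union, not_or] at hk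
    refine mem_flag.2 (Or.inl ⟨k.castPred hk.2, ?_⟩)
    rintro _ ⟨a, rfl⟩ ha
    exact hk.1 ⟨a, ha.trans (Fin.castSucc_castPred k hk.2)⟩)

lemma hornOverHorn_collapseHorn (n : ℕ) : hornOverHorn n ≫ collapseHorn n = 𝟙 _ := by
  refine NatTrans.ext (funext fun m => ConcreteCategory.hom_ext _ _ fun x => ?_)
  exact Subtype.ext (congrArg (fun h => h.app m x.1) (level_collapse (n + 1)))

/-- The collapse is the identity at height 0. This makes `hornToPath` well defined. -/
lemma bottom_faceOverHorn_collapseHorn (n : ℕ) :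
    bottom n 0 ≫ faceOverHorn n ≫ collapseHorn n = boundaryToHorn n := by
  refine NatTrans.ext (funext fun m => ConcreteCategory.hom_ext _ _ fun x => ?_)
  exact Subtype.ext (SSet.stdSimplex.objEquiv.injective (by ext a; rfl))

lemma level_zero_mem_lowerHorn (n j : ℕ) : Set.range (level (n + 1) 0) ∈ lowerHorn n j := by
  refine Or.inr (Or.inl ?_)
  rintro _ ⟨a, rfl⟩
  rfl

/-- The top and sides over `Δ[n + 1]` are the union of `overHorn` and the whole prism over the last
face, which meet in the top and sides of the latter. -/
lemma isPullback_face {C : Type u} [Category.{v} C] [HasFiniteLimits C] (n : ℕ)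
    (Y : SimplicialObject C) :
    IsPullback (Map.restr (SSet.Subcomplex.homOfLE (flag_mono (overHorn_le_lower n))) Y)
      (Map.restr (faceLower n) Y) (Map.restr (faceOverHorn n) Y)
      (Map.restr (flag (lower n 0)).ι Y) := by
  refine Map.isPullback_restr (faceOverHorn n) (flag (lower n 0)).ι
    (SSet.Subcomplex.homOfLE (flag_mono (overHorn_le_lower n))) (faceLower n) rfl (fun m x y hxy => ?_) (fun m x y hxy => ?_)
    (fun m z => ?_) (fun m x y hxy => ?_) Y
  · have h := congrArg Subtype.val hxy
    exact Subtype.ext h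
  · have h : (face n).app m x = (face n).app m y := congrArg Subtype.val hxy
    refine verts_injective (OrderHom.ext _ _ (funext fun a => ?_))
    have h' := congrArg (fun z => verts z a) h
    have h'' := (verts_face n x a).symm.trans (h'.trans (verts_face n y a))
    exact Prod.ext (Fin.castSucc_injective _ (congrArg Prod.fst h'')) (congrArg Prod.snd h'' :)
  · obtain ⟨z, hz⟩ := z
    rcases mem_flag.1 hz with ⟨k, hk⟩ | h
    · obtain ⟨k, rfl⟩ | rfl := k.eq_castSucc_or_eq_last
      · exact Or.inl ⟨⟨z, mem_flag.2 (Or.inl ⟨k, hk⟩)⟩, rfl⟩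
      · have hk' : ∀ a, (verts z a).1 ≠ Fin.last _ := fun a => hk _ ⟨a, rfl⟩
        let s : Fin (m.unop.len + 1) →o Fin (n + 1) :=
          ⟨fun a => (verts z a).1.castPred (hk' a), fun a b hab =>
            Fin.castPred_le_castPred ((verts z).monotone hab).1 (hk' b)⟩
        refine Or.inr ⟨(SSet.stdSimplex.objMk s, z.2), Subtype.ext (verts_injective
          (OrderHom.ext _ _ (funext fun a => (verts_face n _ a).trans (Prod.ext ?_ rfl))))⟩
        exact Fin.castSucc_castPred _ (hk' a)
    · exact Or.inl ⟨⟨z, mem_flag.2 (Or.inr fun v hv hv' => Nat.not_lt_zero _ (h v hv hv'))⟩, rfl⟩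
  · have h : x.1 = (face n).app m y := congrArg Subtype.val hxy
    have hy : y ∈ (flag (lower n 0)).obj m := by
      have hx := mem_flag.1 x.2
      rw [h] at hx
      refine mem_flag.2 ?_
      rcases hx with ⟨k, hk⟩ | hx
      · refine Or.inl ⟨k, ?_⟩
        rintro _ ⟨a, rfl⟩ ha
        exact hk _ ⟨a, rfl⟩ ((congrArg Prod.fst (verts_face n y a)).trans (congrArg Fin.castSucc ha))
      · refine Or.inr ?_
        rintro _ ⟨a, rfl⟩ ha
        exact absurd ha (hx _ ⟨a, rfl⟩)
    exact ⟨⟨y, hy⟩, Subtype.ext h.symm, rfl⟩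

end Prism

open Prism

section

variable {C : Type u} [Category.{v} C] [HasFiniteLimits C] {X Y : SimplicialObject C}

/-- A map from the prism over `Δ[n + 1]` whose restriction to the horn and the top factors through
the collapse restricts to the collapse of its bottom on the horn, the top and the bottom. -/
lemma evHom_ofHom_collapse {n : ℕ} {A : C}
    (H : A ⟶ Map (Δ[n + 1] ⊗ Δ[1]) Y)
    (z : A ⟶ Map (SSet.horn (n + 1) (Fin.last (n + 1)) : SSet.{0}) Y)
    (h : H ≫ Map.restr (flag (overHorn n)).ι Y = z ≫ Map.restr (collapseHorn n) Y) :
    H ≫ Map.evHom (simplex (level (n + 1) 0)) Y ≫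
        Map.ofSimplex (SSet.horn (n + 1) (Fin.last (n + 1))) Y = z ∧
      H ≫ Map.evHom (simplex (level (n + 1) 0)) Y ≫
        Map.ofHom ((flag (lowerHorn n 0)).ι ≫ collapse (n + 1)) Y =
          H ≫ Map.restr (flag (lowerHorn n 0)).ι Y := by
  have h₁ : H ≫ Map.evHom (simplex (level (n + 1) 0)) Y ≫
      Map.ofSimplex (SSet.horn (n + 1) (Fin.last (n + 1))) Y = z := by
    have h₂ : (SSet.horn (n + 1) (Fin.last (n + 1))).ι ≫ simplex (level (n + 1) 0) =
      hornOverHorn n ≫ (flag (overHorn n)).ι := rfl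
    rw [Map.ofSimplex_eq, Map.evHom_ofHom, h₂, Map.restr_comp, ← Category.assoc, h, Category.assoc,
      ← Map.restr_comp, hornOverHorn_collapseHorn, Map.restr_id, Category.comp_id]
  refine ⟨h₁, ?_⟩
  rw [Map.evHom_ofHom]
  refine Map.hom_ext fun m x => ?_
  refine (Category.assoc _ _ _).trans ((congrArg (H ≫ ·) (Map.restr_ev _ _ _)).trans
    (Eq.trans ?_ ((Category.assoc _ _ _).trans (congrArg (H ≫ ·) (Map.restr_ev _ _ _))).symm))
  -- On `overHorn`, `H` factors through the collapse by `h`, and its horn is that of the bottom by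
  -- `h₁`; on the bottom the collapse does nothing.
  rcases mem_lowerHorn_zero (mem_flag.1 x.2) with hx | hx
  · have h₃ : H ≫ Map.restr (flag (overHorn n)).ι Y =
        H ≫ Map.restr ((flag (overHorn n)).ι ≫ collapse (n + 1) ≫ simplex (level (n + 1) 0)) Y := by
      have h₄ : (flag (overHorn n)).ι ≫ collapse (n + 1) ≫ simplex (level (n + 1) 0) =
        collapseHorn n ≫ (SSet.horn (n + 1) (Fin.last (n + 1))).ι ≫
          simplex (level (n + 1) 0) := rfl
      rw [h, h₄, Map.restr_comp, ← Category.assoc, ← Map.evHom_ofHom, ← Map.ofSimplex_eq, h₁]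
    have h₅ := congrArg (fun g => g ≫ Map.ev Y (⟨x.1, hx⟩ : (flag (overHorn n) : SSet.{0}).obj m)) h₃
    simp only [Category.assoc] at h₅
    exact ((congrArg (H ≫ ·) (Map.restr_ev _ _ _)).symm.trans (h₅.symm.trans
      (congrArg (H ≫ ·) (Map.restr_ev _ _ _))) :)
  · refine congrArg (fun z => H ≫ Map.ev Y z) (verts_injective (OrderHom.ext _ _ (funext fun a => ?_)))
    have ha : ((verts x.1 a).2 : ℕ) = 0 := hx _ ⟨a, rfl⟩
    refine Prod.ext ?_ (Fin.ext ha.symm)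
    change (if ((verts x.1 a).2 : ℕ) = 0 then (verts x.1 a).1 else Fin.last (n + 1)) = _
    rw [if_pos ha]
    rfl

variable (f : X ⟶ Y) (n : ℕ)

/-- The morphism that extends a relative horn to the top and the sides of the prism. -/
noncomputable def hornToPath :
    pullback (Map.post (SSet.boundary n) f) (Map.restr (boundaryToHorn n) Y) ⟶
      pullback (Map.post (SSet.boundary n) f) (Map.restr (bottom n 0) Y) :=
  pullback.lift (pullback.fst _ _)
    (pullback.snd _ _ ≫ Map.restr (faceOverHorn n ≫ collapseHorn n) Y) (by
      rw [Category.assoc, ← Map.restr_comp, bottom_faceOverHorn_collapseHorn, pullback.condition])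

/-- The extensions of a filled relative horn to the prism over `Δ[n + 1]`. -/
noncomputable abbrev hornPrism : C :=
  pullback (pullback.snd (f.app (op ⦋n⦌)) (Y.δ (Fin.last (n + 1))) ≫
      Map.ofHom ((flag (lowerHorn n 0)).ι ≫ collapse (n + 1)) Y)
    (Map.restr (flag (lowerHorn n 0)).ι Y)

/-- The map `g` glues the collapsed horn to the prism over the last face, and `r` restricts a prism
over `Δ[n + 1]` to these data. An extension of the glued map determines the point of `hornPrism`:
its bottom is the simplex of `Y`, and the simplex of `X` is part of the data. -/
lemma isPullback_hornPrism :
    ∃ (r : hornPrism f n ⟶ pullback (hornToPath f n) (pathMap f n))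
      (g : pullback (hornToPath f n) (pathMap f n) ⟶ Map (flag (lower (n + 1) 0)) Y),
      r ≫ pullback.fst _ _ = pullback.fst _ _ ≫ relativeHornMap f n ∧
      IsPullback (pullback.snd _ _) r (Map.restr (flag (lower (n + 1) 0)).ι Y) g := by
  have hF := isPullback_face n Y
  have hR₁ : relativeHornMap f n ≫ pullback.fst _ _ = _ := pullback.lift_fst _ _ _
  have hR₂ : relativeHornMap f n ≫ pullback.snd _ _ = _ := pullback.lift_snd _ _ _
  have hW₁ : pathMap f n ≫ pullback.fst _ _ = _ := pullback.lift_fst _ _ _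
  have hW₂ : pathMap f n ≫ pullback.snd _ _ = _ := pullback.lift_snd _ _ _
  have hZ₁ : hornToPath f n ≫ pullback.fst _ _ = pullback.fst _ _ := pullback.lift_fst _ _ _
  have hZ₂ : hornToPath f n ≫ pullback.snd _ _ = _ := pullback.lift_snd _ _ _
  have hQ := pullback.condition (f := hornToPath f n) (g := pathMap f n)
  have hQ₁ : pullback.fst (hornToPath f n) (pathMap f n) ≫ pullback.fst _ _ =
      pullback.snd (hornToPath f n) (pathMap f n) ≫ pullback.fst _ _ ≫
        Map.ofSimplex (SSet.boundary n) X := by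
    rw [← hZ₁, ← Category.assoc, hQ, Category.assoc, hW₁]
  have hQ₂ : pullback.fst (hornToPath f n) (pathMap f n) ≫ pullback.snd _ _ ≫
      Map.restr (faceOverHorn n ≫ collapseHorn n) Y =
      pullback.snd (hornToPath f n) (pathMap f n) ≫ pullback.snd _ _ ≫
        Map.restr (flag (lower n 0)).ι Y := by
    rw [← hZ₂, ← Category.assoc, hQ, Category.assoc, hW₂]
  have hN := pullback.condition
    (f := pullback.snd (f.app (op ⦋n⦌)) (Y.δ (Fin.last (n + 1))) ≫
      Map.ofHom ((flag (lowerHorn n 0)).ι ≫ collapse (n + 1)) Y)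
    (g := Map.restr (flag (lowerHorn n 0)).ι Y)
  let pV : hornPrism f n ⟶ _ := pullback.fst _ _
  let pH : hornPrism f n ⟶ Map (Δ[n + 1] ⊗ Δ[1]) Y := pullback.snd _ _
  -- Restricting the defining equation to the bottom, where the collapse is the identity, identifies
  -- the given simplex of `Y` with the bottom of the prism.
  have hN' : pV ≫ pullback.snd _ _ = pH ≫ Map.evHom (simplex (level (n + 1) 0)) Y := by
    have h₁ := congrArg (fun z => z ≫ Map.evHom (simplexToFlag (lowerHorn n 0) (level (n + 1) 0)
      (level_zero_mem_lowerHorn n 0)) Y) hN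
    simp only [Category.assoc, Map.restr_evHom] at h₁
    have h₂ : Map.ofHom ((flag (lowerHorn n 0)).ι ≫ collapse (n + 1)) Y ≫
        Map.evHom (simplexToFlag (lowerHorn n 0) (level (n + 1) 0)
          (level_zero_mem_lowerHorn n 0)) Y = 𝟙 _ :=
      (Map.ofHom_evHom (T := (flag (lowerHorn n 0) : SSet.{0})) _ (𝟙 ⦋n + 1⦌) _ ((level_collapse (n + 1)).trans
        (SSet.stdSimplex.map_id _).symm) Y).trans (by rw [op_id, Y.map_id])
    refine Eq.trans ?_ h₁
    exact congrArg (pV ≫ ·) (((congrArg (pullback.snd _ _ ≫ ·) h₂).trans (Category.comp_id _)).symm)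
  let u : hornPrism f n ⟶ pullback (f.app (op ⦋n⦌)) (Map.evHom (simplex (level n 0)) Y) :=
    pullback.lift (pV ≫ pullback.fst _ _) (pH ≫ Map.restr (face n) Y) (by
      rw [Category.assoc, Category.assoc, pullback.condition, ← Category.assoc, hN', Category.assoc,
        Map.restr_evHom, level_face, Map.evHom_δ])
  have hu₁ : u ≫ pullback.fst _ _ = _ := pullback.lift_fst _ _ _
  have hu₂ : u ≫ pullback.snd _ _ = _ := pullback.lift_snd _ _ _
  have hN'' : pH ≫ Map.restr (flag (overHorn n)).ι Y =
      pV ≫ pullback.snd _ _ ≫ Map.ofHom ((flag (overHorn n)).ι ≫ collapse (n + 1)) Y := by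
    have h₁ := congrArg (fun z => z ≫ Map.restr (SSet.Subcomplex.homOfLE
      (flag_mono (overHorn_le_lowerHorn n))) Y) hN
    simp only [Category.assoc, Map.ofHom_restr, ← Map.restr_comp] at h₁
    exact h₁.symm
  have hc : (flag (overHorn n)).ι ≫ collapse (n + 1) =
    collapseHorn n ≫ (SSet.horn (n + 1) (Fin.last (n + 1))).ι := rfl
  have hface : faceOverHorn n ≫ (flag (overHorn n)).ι = (flag (lower n 0)).ι ≫ face n := rfl
  let r : hornPrism f n ⟶ pullback (hornToPath f n) (pathMap f n) :=
    pullback.lift (pV ≫ relativeHornMap f n) u (by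
      refine pullback.hom_ext ?_ ?_
      · rw [Category.assoc, Category.assoc, Category.assoc, hZ₁, hR₁, hW₁, ← Category.assoc,
          ← Category.assoc, hu₁]
      · rw [Category.assoc, Category.assoc, Category.assoc, hZ₂, ← Category.assoc (relativeHornMap _ _),
          hR₂, hW₂, ← Category.assoc u, hu₂, Category.assoc, Category.assoc, ← Map.restr_comp,
          ← hface, Map.restr_comp, Map.restr_comp, ← Category.assoc pH, hN'', hc,
          ← Map.ofHom_restr, Map.ofSimplex_eq]
        simp only [Category.assoc])
  have hr₁ : r ≫ pullback.fst _ _ = _ := pullback.lift_fst _ _ _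
  have hr₂ : r ≫ pullback.snd _ _ = _ := pullback.lift_snd _ _ _
  let g : pullback (hornToPath f n) (pathMap f n) ⟶ Map (flag (lower (n + 1) 0)) Y :=
    hF.lift (pullback.fst _ _ ≫ pullback.snd _ _ ≫ Map.restr (collapseHorn n) Y)
      (pullback.snd _ _ ≫ pullback.snd _ _) (by
        rw [Category.assoc, Category.assoc, Category.assoc, ← hQ₂, Map.restr_comp])
  have hg₁ : g ≫ _ = _ := hF.lift_fst _ _ _
  have hg₂ : g ≫ _ = _ := hF.lift_snd _ _ _
  have hι : SSet.Subcomplex.homOfLE (flag_mono (overHorn_le_lower n)) ≫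
    (flag (lower (n + 1) 0)).ι = (flag (overHorn n)).ι := rfl
  have hι' : faceLower n ≫ (flag (lower (n + 1) 0)).ι = face n := rfl
  refine ⟨r, g, hr₁, isPullback_of_elements ?_ ?_ ?_⟩
  · change pH ≫ _ = _
    refine hF.hom_ext ?_ ?_
    · rw [Category.assoc, Category.assoc, ← Map.restr_comp, hι, hN'', hg₁, ← Category.assoc r, hr₁,
        hc, ← Map.ofHom_restr, Category.assoc, ← Category.assoc (relativeHornMap _ _), hR₂,
        Map.ofSimplex_eq, Category.assoc]
    · rw [Category.assoc, Category.assoc, ← Map.restr_comp, hι', hg₂, ← Category.assoc, hr₂, hu₂]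
  · intro A H q hHq
    have h₁ : H ≫ Map.restr (flag (overHorn n)).ι Y =
        (q ≫ pullback.fst _ _ ≫ pullback.snd _ _) ≫ Map.restr (collapseHorn n) Y := by
      rw [← hι, Map.restr_comp, ← Category.assoc, hHq, Category.assoc, hg₁]
      simp only [Category.assoc]
    have h₂ : H ≫ Map.restr (face n) Y = q ≫ pullback.snd _ _ ≫ pullback.snd _ _ := by
      rw [← hι', Map.restr_comp, ← Category.assoc, hHq, Category.assoc, hg₂]
    obtain ⟨h₃, h₄⟩ := evHom_ofHom_collapse H _ h₁
    -- The filler of the relative horn is the bottom of `H`; its last face is the bottom of the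
    -- prism over the last face, which is the image of the simplex of `X`.
    let a : A ⟶ pullback (f.app (op ⦋n⦌)) (Y.δ (Fin.last (n + 1))) :=
      pullback.lift (q ≫ pullback.snd _ _ ≫ pullback.fst _ _)
        (H ≫ Map.evHom (simplex (level (n + 1) 0)) Y) (by
          rw [Category.assoc, Category.assoc, Category.assoc, pullback.condition, Map.evHom_δ,
            ← level_face, ← Map.restr_evHom, ← Category.assoc H, h₂, Category.assoc,
            Category.assoc])
    have ha₁ : a ≫ pullback.fst _ _ = _ := pullback.lift_fst _ _ _
    have ha₂ : a ≫ pullback.snd _ _ = _ := pullback.lift_snd _ _ _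
    let l : A ⟶ hornPrism f n := pullback.lift a H (by
      rw [← Category.assoc, ha₂, Category.assoc, h₄])
    have hl₁ : l ≫ pV = a := pullback.lift_fst _ _ _
    have hl₂ : l ≫ pH = H := pullback.lift_snd _ _ _
    refine ⟨l, hl₂, pullback.hom_ext (pullback.hom_ext ?_ ?_) (pullback.hom_ext ?_ ?_)⟩
    · rw [Category.assoc, Category.assoc, Category.assoc, hQ₁, ← Category.assoc r, hr₂,
        ← Category.assoc u, hu₁, Category.assoc pV, ← Category.assoc l, hl₁, ← Category.assoc a, ha₁]
      simp only [Category.assoc]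
    · rw [Category.assoc, Category.assoc, Category.assoc, ← Category.assoc r, hr₁,
        Category.assoc, hR₂, ← Category.assoc l, hl₁, ← Category.assoc a, ha₂, Category.assoc, h₃]
    · rw [Category.assoc, Category.assoc, Category.assoc, ← Category.assoc r, hr₂, hu₁,
        ← Category.assoc, hl₁, ha₁]
    · rw [Category.assoc, Category.assoc, Category.assoc, ← Category.assoc r, hr₂, hu₂,
        ← Category.assoc, hl₂, h₂]
  · intro A l l' h₁ h₂
    change l ≫ pH = l' ≫ pH at h₁
    refine pullback.hom_ext (pullback.hom_ext ?_ ?_) h₁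
    · change (l ≫ pV) ≫ _ = (l' ≫ pV) ≫ _
      rw [Category.assoc, Category.assoc, ← hu₁, ← hr₂, Category.assoc, ← Category.assoc l, h₂,
        Category.assoc]
    · change (l ≫ pV) ≫ _ = (l' ≫ pV) ≫ _
      rw [Category.assoc, Category.assoc, hN', ← Category.assoc, h₁, Category.assoc]

lemma cover_relativeHornMap_of_cover_pathMap {cover : MorphismProperty C} [IsDescent cover] {k : ℕ}
    (hY : IsKGroupoid cover k Y) (h : cover (pathMap f n)) : cover (relativeHornMap f n) := by
  obtain ⟨r, g, hr, hrg⟩ := isPullback_hornPrism f n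
  have h₁ : cover r := IsDescent.of_isPullback hrg (cover_restr_lower hY (n + 1))
  have h₂ : cover (pullback.fst (hornToPath f n) (pathMap f n)) :=
    IsDescent.of_isPullback (IsPullback.of_hasPullback _ _).flip h
  have h₃ : cover (pullback.fst _ _ : hornPrism f n ⟶ _) :=
    IsDescent.of_isPullback (IsPullback.of_hasPullback _ _).flip (cover_restr_lowerHorn hY n)
  -- Precomposed with the cover `h₃`, the relative horn map becomes `r` followed by the base change
  -- of `pathMap f n`, both covers.
  refine IsDescent.of_precomp _ _ h₃ ?_
  rw [← hr]
  exact IsDescent.comp_mem _ _ h₁ h₂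

end

end HigherGroupoid

theorem mainTheorem6 {C : Type u} [Category.{v} C] [HasFiniteLimits C]
    (cover : MorphismProperty C) [HigherGroupoid.IsDescent cover] (k : ℕ)
    {X Y : SimplicialObject C} (hX : HigherGroupoid.IsKGroupoid cover k X)
    (hY : HigherGroupoid.IsKGroupoid cover k Y) (f : X ⟶ Y) :
    HigherGroupoid.IsWeakEquivalence cover f ↔
      ∀ n : ℕ, cover (HigherGroupoid.relativeHornMap f n) :=
  (HigherGroupoid.isWeakEquivalence_iff_pathMap cover f).trans <| forall_congr' fun n =>
    ⟨HigherGroupoid.cover_relativeHornMap_of_cover_pathMap f n hY,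
      HigherGroupoid.cover_pathMap_of_cover_relativeHornMap f n hY⟩
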